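/- **Setting.** Let $f:\mathbb R^d\to\mathbb R$ be differentiable and bounded below, with $\|\nabla f(x)-\nabla f(y)\|\le L\|x-y\|$ for all $x,y$, where $L>0$. Let $x_0\in\mathbb R^d$ and $\Delta:=f(x_0)-\inf f>0$. Let $1<p\le 2$, $\sigma\ge 0$, $\varepsilon>0$. Let $G(x;\xi)$, $\xi\sim\mathcal D$, be a (jointly measurable) stochastic gradient with $\mathbb E[G(x;\xi)]=\nabla f(x)$ and $\mathbb E\|G(x;\xi)-\nabla f(x)\|^p\le\sigma^p$ for every $x$. There are $n\ge 1$ workers, with $\tau_1,\dots,\tau_n>0$. **Algorithm (RANSGDm)** with delay threshold $R$, stepsize $\eta$, momentum parameter $\beta$ and number of updates $K$. The server starts with $k=0$, $v_0=0$ and the point $x_0$. Each worker repeatedly receives the current pair $(x_k,k)$ from the server, computes a single stochastic gradient at $x_k$ with a fresh sample of $\mathcal D$, delivers it together with the stamp $k$, and starts again; communication takes no time. Deliveries are processed in the order of their times (ties in any order), and after each of them the delivering worker receives the current pair. When a gradient $g$ with stamp $\iota$ is delivered and $k-\iota<R$, the server sets $$v_{k+1}=\beta_k v_k+(1-\beta)g,\qquad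 x_{k+1}=x_k-\eta\,\frac{v_{k+1}}{\|v_{k+1}\|},\qquad k\leftarrow k+1,$$ where $\beta_k=0$ for $k\le 1$, $\beta_k=\beta$ for $k>1$, and $0/\|0\|:=0$; if $k-\iota\ge R$, the gradient is discarded. The server stops as soon as $k=K$. The output $\hat x$ is $x_J$ with $J$ uniform on $\{0,\dots,K-1\}$, independent of the execution. **Fixed computation model.** All workers start at time $0$, and every gradient computation of worker $i$ takes at most $\tau_i$ units of time. The computation times are otherwise arbitrary: they may be random and may depend on everything that has happened so far, but not on samples that have not been delivered yet. **Parameters.** $$R=\left\lceil\tfrac1\alpha\right\rceil,\quad \eta=\frac{\alpha\varepsilon}{24L},\quad \beta=1-\alpha,\quad K=\left\lceil\frac{72L\Delta}{\alpha\varepsilon^2}\right\rceil,\quad \alpha=\min\left\{1,\left(\frac{\varepsilon}{3\cdot 2^{(p+1)/p}\sigma}\right)^{\frac p{p-1}}\right\}\ \ (\alpha=1\text{ if }\sigma=0).$$ **Claim.** For every $p\in(1,2]$ there is a constant $C>0$, depending only on $p$, such that in every such setting the algorithm always makes its $K$ updates and stops, its output satisfies $\mathbb E\|\nabla f(\hat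 x)\|\le\varepsilon$, and, if $\varepsilon\le\sqrt{2L\Delta}$, then on every sample path the wall-clock time at which it stops is at most $$C\,\min_{1\le m\le n}\left[\left(\frac1m\sum_{i=1}^m\frac1{\tau_i}\right)^{-1}\left(\frac{L\Delta}{\varepsilon^2}+\frac{L\sigma^{\frac p{p-1}}\Delta}{m\,\varepsilon^{\frac{3p-2}{p-1}}}\right)\right].$$ If $\varepsilon>\sqrt{2L\Delta}$, then already $\|\nabla f(x_0)\|\le\varepsilon$. -/

import Mathlib

open MeasureTheory ProbabilityTheory

noncomputable section

/-- `f` is `L`-smooth (differentiable with `L`-Lipschitz gradient) and bounded below. -/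
structure IsSmoothObjective {d : ℕ} (f : EuclideanSpace ℝ (Fin d) → ℝ) (L : ℝ) : Prop where
  differentiable : Differentiable ℝ f
  lipschitz_gradient : ∀ x y, ‖gradient f x - gradient f y‖ ≤ L * ‖x - y‖
  bddBelow : BddBelow (Set.range f)

/-- The initial gap `f x₀ - inf f`. -/
def initialGap {d : ℕ} (f : EuclideanSpace ℝ (Fin d) → ℝ) (x₀ : EuclideanSpace ℝ (Fin d)) : ℝ :=
  f x₀ - ⨅ x, f x

/-- `G x ξ`, `ξ ∼ D`, is an unbiased estimate of the gradient of `f` at `x`, with `p`-th central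
moment at most `σ ^ p`. -/
structure IsPBCMOracle {d : ℕ} {Ξ : Type*} [MeasurableSpace Ξ] (D : Measure Ξ)
    (f : EuclideanSpace ℝ (Fin d) → ℝ)
    (G : EuclideanSpace ℝ (Fin d) → Ξ → EuclideanSpace ℝ (Fin d)) (p σ : ℝ) : Prop where
  measurable : Measurable (Function.uncurry G)
  integrable : ∀ x, Integrable (G x) D
  unbiased : ∀ x, ∫ z, G x z ∂D = gradient f x
  moment_le : ∀ x, ∫⁻ z, ‖G x z - gradient f x‖ₑ ^ p ∂D ≤ ENNReal.ofReal (σ ^ p)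

/-- State of the server and of the `n` workers. The server stores the number `k` of updates made
so far, the iterates `iter 0, …, iter k` and the momentum `v`; `clock` is the wall-clock time of the
last processed event. Worker `i` is computing a gradient at `point i`, which it received with the
stamp `stamp i`, and will deliver it at time `finish i`. -/
structure RState (n d : ℕ) where
  k : ℕ
  iter : ℕ → EuclideanSpace ℝ (Fin d)
  v : EuclideanSpace ℝ (Fin d)
  clock : ℝ
  point : Fin n → EuclideanSpace ℝ (Fin d)
  stamp : Fin n → ℕ
  finish : Fin n → ℝ

namespace RState

/-- At time `0` every worker has received `(x₀, 0)` and starts its first computation, which takes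
`h₀ i` units of time. -/
def init {n d : ℕ} (x₀ : EuclideanSpace ℝ (Fin d)) (h₀ : Fin n → ℝ) : RState n d where
  k := 0
  iter := fun _ => x₀
  v := 0
  clock := 0
  point := fun _ => x₀
  stamp := fun _ => 0
  finish := h₀

/-- The server update with the gradient `g`:
`v_{k+1} = β_k v_k + (1 - β) g`, where `β_k = 0` for `k ≤ 1` and `β_k = β` for `k > 1`, and
`x_{k+1} = x_k - η v_{k+1} / ‖v_{k+1}‖` (with `0 / 0 = 0`). -/
def update {n d : ℕ} (η β : ℝ) (S : RState n d) (g : EuclideanSpace ℝ (Fin d)) : RState n d :=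
  let v' := (if S.k ≤ 1 then 0 else β) • S.v + (1 - β) • g
  { S with
    k := S.k + 1
    iter := Function.update S.iter (S.k + 1) (S.iter S.k - (η / ‖v'‖) • v')
    v := v' }

/-- Processing the delivery of the gradient `g` by worker `i`. Nothing happens once the server has
made its `K` updates. Otherwise the server uses `g` if its delay `k - stamp i` is below `R` and
discards it if not; then worker `i` receives the current `(x_k, k)` and starts its next
computation, which takes `h` units of time. -/
def step {n d : ℕ} (K R : ℕ) (η β : ℝ) (S : RState n d) (i : Fin n)
    (g : EuclideanSpace ℝ (Fin d)) (h : ℝ) : RState n d :=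
  if S.k < K then
    let S' := if S.k - S.stamp i < R then S.update η β g else S
    { S' with
      clock := S.finish i
      point := Function.update S.point i (S'.iter S'.k)
      stamp := Function.update S.stamp i S'.k
      finish := Function.update S.finish i (S.finish i + h) }
  else S

/-- The state after the first `s` deliveries. The `s`-th delivery (counted from `0`) is made by
worker `c s`, with the sample `z s`; `h 0 i` is the duration of the first computation of worker `i`
and `h (s + 1) (c s)` is that of the computation which worker `c s` starts after delivery `s`. -/
def run {n d : ℕ} {Ξ : Type*} (G : EuclideanSpace ℝ (Fin d) → Ξ → EuclideanSpace ℝ (Fin d))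
    (K R : ℕ) (η β : ℝ) (x₀ : EuclideanSpace ℝ (Fin d))
    (c : ℕ → Fin n) (z : ℕ → Ξ) (h : ℕ → Fin n → ℝ) : ℕ → RState n d
  | 0 => init x₀ (h 0)
  | s + 1 =>
    let S := run G K R η β x₀ c z h s
    S.step K R η β (c s) (G (S.point (c s)) (z s)) (h (s + 1) (c s))

/-- The state in which the server leaves the loop `while k < K` (the initial state if it never
does). -/
def final {n d : ℕ} {Ξ : Type*} (G : EuclideanSpace ℝ (Fin d) → Ξ → EuclideanSpace ℝ (Fin d))
    (K R : ℕ) (η β : ℝ) (x₀ : EuclideanSpace ℝ (Fin d))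
    (c : ℕ → Fin n) (z : ℕ → Ξ) (h : ℕ → Fin n → ℝ) : RState n d :=
  run G K R η β x₀ c z h (sInf {s | ¬ (run G K R η β x₀ c z h s).k < K})

end RState

/-- The fixed computation model for an execution of the algorithm on the probability space
`(Ω, μ)`. Here `ℱ s` is the information available just before delivery `s`. Every delivered
gradient uses a fresh sample of `D`. Computation times are arbitrary in `[0, τ i]`: they may be
random and may depend on the whole past, but do not anticipate samples not delivered yet.
Gradients are delivered in the order of their finishing times, with ties broken arbitrarily. -/
structure IsFixedComputation {n d : ℕ} {Ω Ξ : Type*} {mΩ : MeasurableSpace Ω} [MeasurableSpace Ξ]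
    (μ : Measure Ω) (ℱ : Filtration ℕ mΩ) (D : Measure Ξ) (τ : Fin n → ℝ)
    (G : EuclideanSpace ℝ (Fin d) → Ξ → EuclideanSpace ℝ (Fin d))
    (K R : ℕ) (η β : ℝ) (x₀ : EuclideanSpace ℝ (Fin d))
    (c : ℕ → Ω → Fin n) (z : ℕ → Ω → Ξ) (h : ℕ → Fin n → Ω → ℝ) : Prop where
  sample_measurable : ∀ s, Measurable[ℱ (s + 1)] (z s)
  sample_law : ∀ s, μ.map (z s) = D
  sample_fresh : ∀ s, Indep (MeasurableSpace.comap (z s) inferInstance) (ℱ s) μ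
  duration_measurable : ∀ s i, Measurable[ℱ s] (h s i)
  duration_nonneg : ∀ s i ω, 0 ≤ h s i ω
  duration_le : ∀ s i ω, h s i ω ≤ τ i
  worker_measurable : ∀ s, Measurable[ℱ s] (c s)
  earliest : ∀ s ω i,
    (RState.run G K R η β x₀ (fun t => c t ω) (fun t => z t ω) (fun t j => h t j ω) s).finish
        (c s ω) ≤
      (RState.run G K R η β x₀ (fun t => c t ω) (fun t => z t ω) (fun t j => h t j ω) s).finish i

/-- `J` is uniform on `{0, …, K - 1}` and independent of the whole execution. -/
structure IsUniformIndex {Ω : Type*} {mΩ : MeasurableSpace Ω} (μ : Measure Ω)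
    (ℱ : Filtration ℕ mΩ) (K : ℕ) (J : Ω → ℕ) : Prop where
  measurable : Measurable J
  law : μ.map J = uniformOn (Set.Iio K)
  indep : Indep (MeasurableSpace.comap J inferInstance) (⨆ s, ℱ s) μ

/-- The random point `X` satisfies `𝔼 ‖∇ f(X)‖ ≤ ε`. -/
def IsEpsStationary {d : ℕ} {Ω : Type*} {mΩ : MeasurableSpace Ω} (μ : Measure Ω)
    (f : EuclideanSpace ℝ (Fin d) → ℝ) (ε : ℝ) (X : Ω → EuclideanSpace ℝ (Fin d)) : Prop :=
  Integrable (fun ω => ‖gradient f (X ω)‖) μ ∧ ∫ ω, ‖gradient f (X ω)‖ ∂μ ≤ ε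

/-- `α = min {1, (ε / (3 · 2^{(p+1)/p} σ))^{p/(p-1)}}`, which is `1` for `σ = 0`. -/
def paramAlpha (p σ ε : ℝ) : ℝ :=
  if σ = 0 then 1 else min 1 ((ε / (3 * 2 ^ ((p + 1) / p) * σ)) ^ (p / (p - 1)))

/-- Delay threshold. -/
def paramR (p σ ε : ℝ) : ℕ := ⌈1 / paramAlpha p σ ε⌉₊

/-- Step size. -/
def paramEta (p σ ε L : ℝ) : ℝ := paramAlpha p σ ε * ε / (24 * L)

/-- Momentum parameter. -/
def paramBeta (p σ ε : ℝ) : ℝ := 1 - paramAlpha p σ ε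

/-- Number of updates. -/
def paramK (p σ ε L Δ : ℝ) : ℕ := ⌈72 * L * Δ / (paramAlpha p σ ε * ε ^ 2)⌉₊

/-- The minimum over `1 ≤ m ≤ n` of
`(1/m ∑_{i ≤ m} 1/τ_i)⁻¹ (LΔ/ε² + L σ^{p/(p-1)} Δ / (m ε^{(3p-2)/(p-1)}))`.
The workers `1, …, m` are the elements `i` of `Fin n` with `i < m`. -/
def timeRate {n : ℕ} (hn : 1 ≤ n) (τ : Fin n → ℝ) (L Δ σ p ε : ℝ) : ℝ :=
  (Finset.Icc 1 n).inf' (Finset.nonempty_Icc.mpr hn) fun m : ℕ =>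
    ((1 / (m : ℝ)) * ∑ i ∈ Finset.univ.filter (fun i : Fin n => (i : ℕ) < m), 1 / τ i)⁻¹ *
      (L * Δ / ε ^ 2 +
        L * σ ^ (p / (p - 1)) * Δ / ((m : ℝ) * ε ^ ((3 * p - 2) / (p - 1))))

end

/-! The convergence bound and the time bound are proved separately; both work along each sample path
as far as possible.

Convergence. A step along `v / ‖v‖` lowers `f` by `η ‖∇f(x)‖`, up to `2 η ‖v - ∇f(x)‖ + L η² / 2`
(`normalized_step`), so it suffices to control `v - ∇f` on average over the updates. This error is
split into noise and bias. The bias is bounded pathwise: normalization makes every step at most `η`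
long and accepted gradients are at most `R - 1` updates old, so staleness and drift together leave a
bias of order `L η / α`, plus a geometrically decaying trace of `∇f(x₀)` (`norm_bias_le`). The noise
(`noisePart`) is a weighted sum of martingale differences with only a `p`-th moment. By the von
Bahr–Esseen inequality (`norm_add_rpow_le`) a fresh sample adds at most `2 (1 - β)^p σ^p` to the
`p`-th moment, while the old noise is damped by `β` (`lintegral_noise_succ_le`). The choice of `α`
brings the average `p`-th moment down to `(ε / 6)^p`, and Young's inequality passes to first
moments. Since the deliveries that cause updates are random, all sums run over deliveries with an
acceptance indicator, which is known before the sample is revealed. If `√(2LΔ) < ε / 2`, the initial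
bias cannot be absorbed, but then the whole trajectory stays where the gradient is at most `ε`.

Time. While fewer than `R` updates have been made since some moment, only the first delivery of a
worker after that moment can be too stale. In time `T` worker `i` thus contributes at least about `T
/ τ i - 2` updates, and summing over any set `A` of workers bounds the duration of `R` updates by
`(R + 2 |A|) / ∑_A 1 / τ i` (`clock_succ_le_add`). About `K / R ≲ LΔ / ε²` such epochs suffice, and
`R ≈ 1 / α` gives the rate. -/

noncomputable section

/-! ### Moment inequalities in a Hilbert space. -/

section Analysis

variable {E : Type*} [NormedAddCommGroup E] [InnerProductSpace ℝ E]

/-- The tangent bound for `‖·‖ ^ p`, `0 ≤ p ≤ 2`, from concavity of `t ↦ t ^ (p / 2)`. -/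
lemma norm_add_rpow_le_tangent {p : ℝ} (hp₀ : 0 ≤ p) (hp₂ : p ≤ 2) {a : E} (ha : a ≠ 0) (b : E) :
    ‖a + b‖ ^ p ≤ ‖a‖ ^ p + ‖a‖ ^ (p - 2) * (p * inner ℝ a b + p / 2 * ‖b‖ ^ 2) := by
  have hA : 0 < ‖a‖ := norm_pos_iff.mpr ha
  have hsq := norm_add_sq_real a b
  set x := (2 * inner ℝ a b + ‖b‖ ^ 2) / ‖a‖ ^ 2 with hx
  have hx1 : ‖a + b‖ ^ 2 = ‖a‖ ^ 2 * (1 + x) := by rw [hsq, hx]; field_simp; ring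
  have h1x : 0 ≤ 1 + x := by
    by_contra! hneg
    have := sq_nonneg ‖a + b‖
    rw [hx1] at this
    nlinarith [sq_pos_of_pos hA]
  have key := rpow_one_add_le_one_add_mul_self (s := x) (p := p / 2) (by linarith)
    (by linarith) (by linarith)
  have h1 : ∀ y : ℝ, 0 ≤ y → y ^ p = (y ^ 2) ^ (p / 2) := fun y hy => by
    rw [← Real.rpow_natCast y 2, ← Real.rpow_mul hy]; congr 1; push_cast; ring
  have h2 : ‖a‖ ^ (p - 2) * ‖a‖ ^ 2 = ‖a‖ ^ p := by
    rw [← Real.rpow_natCast ‖a‖ 2, ← Real.rpow_add hA]; congr 1; push_cast; ring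
  have h3 : 2 * inner ℝ a b + ‖b‖ ^ 2 = x * ‖a‖ ^ 2 := by rw [hx]; field_simp
  calc ‖a + b‖ ^ p = ‖a‖ ^ p * (1 + x) ^ (p / 2) := by
        rw [h1 _ (norm_nonneg _), hx1, Real.mul_rpow (sq_nonneg _) h1x, ← h1 _ (norm_nonneg _)]
    _ ≤ ‖a‖ ^ p * (1 + p / 2 * x) := by gcongr
    _ = ‖a‖ ^ p + ‖a‖ ^ (p - 2) * (p / 2 * (x * ‖a‖ ^ 2)) := by rw [← h2]; ring
    _ = _ := by rw [← h3]; ring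

/-- The pointwise inequality behind the von Bahr–Esseen inequality. -/
lemma norm_add_rpow_le {p : ℝ} (hp₁ : 1 < p) (hp₂ : p ≤ 2) (a b : E) :
    ‖a + b‖ ^ p ≤ ‖a‖ ^ p + inner ℝ ((p * ‖a‖ ^ (p - 2)) • a) b + 2 * ‖b‖ ^ p := by
  have hp : 0 < p := by linarith
  have hpow : ∀ y : ℝ, 0 < y → y ^ (p - 2) * y ^ 2 = y ^ p := fun y hy => by
    rw [← Real.rpow_natCast y 2, ← Real.rpow_add hy]; congr 1; push_cast; ring
  rw [inner_smul_left]
  simp only [conj_trivial]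
  have hbp : 0 ≤ ‖b‖ ^ p := by positivity
  rcases eq_or_ne a 0 with rfl | ha
  · simp [Real.zero_rpow hp.ne']; linarith
  rcases eq_or_ne b 0 with rfl | hb
  · simp [Real.zero_rpow hp.ne']
  have hA : 0 < ‖a‖ := norm_pos_iff.mpr ha
  have hB : 0 < ‖b‖ := norm_pos_iff.mpr hb
  -- The tangent bound is taken at the longer vector. If that is `a`, the quadratic remainder is
  -- below `‖b‖ ^ p`; if it is `b`, the linear term has the wrong weight `‖b‖ ^ (p - 2)`, and
  -- correcting it costs the second `‖b‖ ^ p`.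
  rcases le_or_gt ‖b‖ ‖a‖ with hba | hab
  · have h := norm_add_rpow_le_tangent hp.le hp₂ ha b
    have h1 : ‖a‖ ^ (p - 2) ≤ ‖b‖ ^ (p - 2) :=
      Real.rpow_le_rpow_of_nonpos hB hba (by linarith)
    have h2 : ‖a‖ ^ (p - 2) * ‖b‖ ^ 2 ≤ ‖b‖ ^ p := by
      rw [← hpow _ hB]; gcongr
    have h3 : 0 ≤ ‖a‖ ^ (p - 2) * ‖b‖ ^ 2 := by positivity
    nlinarith
  · have h := norm_add_rpow_le_tangent hp.le hp₂ hb a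
    rw [add_comm b a] at h
    have h1 : ‖b‖ ^ (p - 2) ≤ ‖a‖ ^ (p - 2) :=
      Real.rpow_le_rpow_of_nonpos hA hab.le (by linarith)
    have hin : -(‖a‖ * ‖b‖) ≤ inner ℝ a b := by
      have := abs_real_inner_le_norm a b
      linarith [neg_abs_le (inner ℝ a b)]
    have hcomm : inner ℝ b a = inner ℝ a b := real_inner_comm _ _
    have hy := Real.geom_mean_le_arith_mean2_weighted (w₁ := p - 1) (w₂ := 2 - p) (p₁ := ‖a‖)
      (p₂ := ‖b‖) (by linarith) (by linarith) hA.le hB.le (by ring)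
    have e1 : ‖a‖ ^ (p - 2) * ‖a‖ = ‖a‖ ^ (p - 1) := by
      rw [← Real.rpow_add_one hA.ne']; congr 1; ring
    have e2 : ‖b‖ ^ (p - 2) * ‖b‖ ^ (2 - p) = 1 := by
      rw [← Real.rpow_add hB]; simp
    have hQ : 0 < ‖b‖ ^ (p - 2) := by positivity
    have hy' : ‖a‖ ^ (p - 2) * ‖a‖ ≤ ‖b‖ ^ (p - 2) * ((p - 1) * ‖a‖ + (2 - p) * ‖b‖) := by
      calc ‖a‖ ^ (p - 2) * ‖a‖
          = ‖b‖ ^ (p - 2) * (‖a‖ ^ (p - 1) * ‖b‖ ^ (2 - p)) := by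
            rw [e1]; linear_combination -(‖a‖ ^ (p - 1)) * e2
        _ ≤ _ := by gcongr
    have hb2 := hpow _ hB
    have ha2 := hpow _ hA
    set P := ‖a‖ ^ (p - 2)
    set Q := ‖b‖ ^ (p - 2)
    have f1 : ‖a‖ * ‖b‖ * (P - Q) ≤ (2 - p) * ‖b‖ ^ p := by
      rw [← hb2]
      have : P * ‖a‖ * ‖b‖ ≤ Q * ((p - 1) * ‖a‖ + (2 - p) * ‖b‖) * ‖b‖ := by gcongr
      have h0 : 0 ≤ (2 - p) * (Q * ‖a‖ * ‖b‖) := by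
        have : 0 ≤ 2 - p := by linarith
        positivity
      linarith
    -- `p (2 - p) = 1 - (p - 1)² ≤ 1`.
    have f2 : p * (‖a‖ * ‖b‖ * (P - Q)) ≤ ‖b‖ ^ p := by
      have : p * (‖a‖ * ‖b‖ * (P - Q)) ≤ p * ((2 - p) * ‖b‖ ^ p) := by gcongr
      nlinarith [mul_nonneg (sq_nonneg (p - 1)) hbp]
    have f3 : inner ℝ a b * (Q - P) ≤ ‖a‖ * ‖b‖ * (P - Q) := by nlinarith
    have f3' : p * (inner ℝ a b * (Q - P)) ≤ p * (‖a‖ * ‖b‖ * (P - Q)) := by gcongr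
    have f4 : p / 2 * (Q * ‖a‖ ^ 2) ≤ ‖a‖ ^ p := by
      rw [← ha2]
      have : Q * ‖a‖ ^ 2 ≤ P * ‖a‖ ^ 2 := by gcongr
      have : 0 ≤ Q * ‖a‖ ^ 2 := by positivity
      nlinarith
    rw [hcomm] at h
    linarith

/-- Young's inequality in the form `x ≤ x ^ p / (p l ^ (p - 1)) + (1 - 1 / p) l`. -/
lemma le_rpow_div_add {p x l : ℝ} (hp₁ : 1 < p) (hx : 0 ≤ x) (hl : 0 < l) :
    x ≤ 1 / (p * l ^ (p - 1)) * x ^ p + (1 - 1 / p) * l := by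
  have hp : 0 < p := by linarith
  -- Bernoulli's inequality for `(x / l) ^ p`, that is, the tangent to `t ^ p` at `t = 1`.
  have h := one_add_mul_self_le_rpow_one_add (s := x / l - 1) (p := p)
    (by have : 0 ≤ x / l := by positivity
        linarith) hp₁.le
  rw [add_sub_cancel, Real.div_rpow hx hl.le] at h
  have hl' : l ^ p = l ^ (p - 1) * l := by
    rw [← Real.rpow_add_one hl.ne']; congr 1; ring
  rw [hl'] at h
  have hL : 0 < l ^ (p - 1) := by positivity
  rw [← sub_nonneg]
  have : 1 / (p * l ^ (p - 1)) * x ^ p + (1 - 1 / p) * l - x =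
      l / p * (x ^ p / (l ^ (p - 1) * l) - (1 + p * (x / l - 1))) := by
    field_simp; ring
  rw [this]
  exact mul_nonneg (by positivity) (by linarith)

/-- Adding a centered noise vector raises the `p`-th moment at most by twice that of the noise. -/
lemma lintegral_enorm_add_rpow_le [CompleteSpace E] {Ξ : Type*} [MeasurableSpace Ξ] {D : Measure Ξ}
    [IsProbabilityMeasure D]
    {p σ : ℝ} (hp₁ : 1 < p) (hp₂ : p ≤ 2) (hσ : 0 ≤ σ) {X : Ξ → E} (hX : Integrable X D)
    (hmean : ∫ z, X z ∂D = 0) (hmom : ∫⁻ z, ‖X z‖ₑ ^ p ∂D ≤ ENNReal.ofReal (σ ^ p))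
    (u : E) {a : ℝ} (ha : 0 ≤ a) :
    ∫⁻ z, ‖u + a • X z‖ₑ ^ p ∂D ≤ ‖u‖ₑ ^ p + ENNReal.ofReal (2 * a ^ p * σ ^ p) := by
  have hp : 0 < p := by linarith
  have hen : ∀ y : E, ‖y‖ₑ ^ p = ENNReal.ofReal (‖y‖ ^ p) := fun y => by
    rw [← ofReal_norm, ENNReal.ofReal_rpow_of_nonneg (norm_nonneg _) hp.le]
  have hXp : Integrable (fun z => ‖X z‖ ^ p) D := by
    refine ⟨(hX.1.norm.aemeasurable.pow_const p).aestronglyMeasurable, ?_⟩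
    rw [hasFiniteIntegral_iff_ofReal (Filter.Eventually.of_forall fun z => by positivity)]
    simp only [hen] at hmom
    exact hmom.trans_lt ENNReal.ofReal_lt_top
  have hXσ : ∫ z, ‖X z‖ ^ p ∂D ≤ σ ^ p := by
    rw [integral_eq_lintegral_of_nonneg_ae (Filter.Eventually.of_forall fun z => by positivity)
      hXp.1]
    refine ENNReal.toReal_le_of_le_ofReal (by positivity) ?_
    simpa only [hen] using hmom
  set φ : E := (p * ‖u‖ ^ (p - 2)) • u
  have hint : Integrable (fun z => inner ℝ φ (a • X z)) D := (hX.smul a).const_inner φ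
  have hpt : ∀ z, ‖u + a • X z‖ ^ p ≤ ‖u‖ ^ p + inner ℝ φ (a • X z) + 2 * a ^ p * ‖X z‖ ^ p := by
    intro z
    refine (norm_add_rpow_le hp₁ hp₂ u (a • X z)).trans_eq ?_
    rw [norm_smul, Real.norm_of_nonneg ha, Real.mul_rpow ha (norm_nonneg _), mul_assoc]
  have hrhs : Integrable
      (fun z => ‖u‖ ^ p + inner ℝ φ (a • X z) + 2 * a ^ p * ‖X z‖ ^ p) D :=
    ((integrable_const _).add hint).add (hXp.const_mul _)
  calc ∫⁻ z, ‖u + a • X z‖ₑ ^ p ∂D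
      ≤ ∫⁻ z, ENNReal.ofReal (‖u‖ ^ p + inner ℝ φ (a • X z) + 2 * a ^ p * ‖X z‖ ^ p) ∂D := by
        refine lintegral_mono fun z => ?_
        rw [hen]
        exact ENNReal.ofReal_le_ofReal (hpt z)
    _ = ENNReal.ofReal (∫ z, ‖u‖ ^ p + inner ℝ φ (a • X z) + 2 * a ^ p * ‖X z‖ ^ p ∂D) := by
        rw [ofReal_integral_eq_lintegral_ofReal hrhs]
        exact Filter.Eventually.of_forall fun z => le_trans (by positivity) (hpt z)
    _ ≤ ENNReal.ofReal (‖u‖ ^ p + 2 * a ^ p * σ ^ p) := by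
        apply ENNReal.ofReal_le_ofReal
        have h1 : ∫ z, ‖u‖ ^ p + inner ℝ φ (a • X z) + 2 * a ^ p * ‖X z‖ ^ p ∂D =
            ∫ z, ‖u‖ ^ p + inner ℝ φ (a • X z) ∂D + ∫ z, 2 * a ^ p * ‖X z‖ ^ p ∂D :=
          integral_add ((integrable_const _).add hint) (hXp.const_mul _)
        -- The vector `φ` depends on `u` only, so centering removes the linear term.
        have h2 : ∫ z, inner ℝ φ (a • X z) ∂D = 0 := by
          simp only [inner_smul_right]
          rw [integral_const_mul, integral_inner hX, hmean, inner_zero_right, mul_zero]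
        rw [h1, integral_add (integrable_const _) hint, h2, integral_const_mul]
        simp only [integral_const, probReal_univ, one_smul, add_zero]
        gcongr
    _ = ‖u‖ₑ ^ p + ENNReal.ofReal (2 * a ^ p * σ ^ p) := by
        rw [ENNReal.ofReal_add (by positivity) (by positivity), hen]

end Analysis

/-! ### Consequences of smoothness. -/

namespace IsSmoothObjective

variable {d : ℕ} {f : EuclideanSpace ℝ (Fin d) → ℝ} {L : ℝ}

lemma continuous_gradient (hf : IsSmoothObjective f L) :
    Continuous (gradient f) := by
  refine (LipschitzWith.of_dist_le_mul (K := L.toNNReal) fun x y => ?_).continuous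
  rw [dist_eq_norm, dist_eq_norm]
  refine (hf.lipschitz_gradient x y).trans ?_
  gcongr
  exact Real.le_coe_toNNReal L

/-- The descent inequality. -/
lemma le_quadratic (hf : IsSmoothObjective f L) (x u : EuclideanSpace ℝ (Fin d)) :
    f (x + u) ≤ f x + inner ℝ (gradient f x) u + L / 2 * ‖u‖ ^ 2 := by
  set φ : ℝ → ℝ := fun t => f (x + t • u) - t * inner ℝ (gradient f x) u - L / 2 * t ^ 2 * ‖u‖ ^ 2
  have hder : ∀ t, HasDerivAt φ
      (inner ℝ (gradient f (x + t • u)) u - inner ℝ (gradient f x) u - L * t * ‖u‖ ^ 2) t := by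
    intro t
    have h1 : HasDerivAt (fun t : ℝ => x + t • u) u t := by
      simpa using ((hasDerivAt_id t).smul_const u).const_add x
    have h2 := (hf.differentiable (x + t • u)).hasGradientAt.hasFDerivAt.comp_hasDerivAt t h1
    have h3 : HasDerivAt (fun t : ℝ => t * inner ℝ (gradient f x) u)
        (inner ℝ (gradient f x) u) t := by
      simpa using (hasDerivAt_id t).mul_const (inner ℝ (gradient f x) u)
    have h4 : HasDerivAt (fun t : ℝ => L / 2 * t ^ 2 * ‖u‖ ^ 2) (L * t * ‖u‖ ^ 2) t := by
      have := ((hasDerivAt_pow 2 t).const_mul (L / 2)).mul_const (‖u‖ ^ 2)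
      refine this.congr_deriv ?_
      rw [Nat.cast_ofNat, pow_one]
      ring
    have h5 := (h2.sub h3).sub h4
    simp only [InnerProductSpace.toDual_apply_apply] at h5
    exact h5
  have hanti : AntitoneOn φ (Set.Ici 0) := by
    apply antitoneOn_of_deriv_nonpos (convex_Ici 0)
    · exact fun t _ => (hder t).continuousAt.continuousWithinAt
    · exact fun t _ => (hder t).differentiableAt.differentiableWithinAt
    · intro t ht
      rw [interior_Ici, Set.mem_Ioi] at ht
      rw [(hder t).deriv, ← inner_sub_left]
      have h1 := real_inner_le_norm (gradient f (x + t • u) - gradient f x) u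
      have h2 := hf.lipschitz_gradient (x + t • u) x
      rw [add_sub_cancel_left, norm_smul, Real.norm_of_nonneg ht.le] at h2
      nlinarith [norm_nonneg u]
  have := hanti (Set.mem_Ici.mpr le_rfl) (Set.mem_Ici.mpr zero_le_one) zero_le_one
  simp only [φ, one_smul, zero_smul, add_zero, one_mul, zero_mul, sub_zero] at this
  linarith

lemma sub_le_initialGap (hf : IsSmoothObjective f L) (x₀ x : EuclideanSpace ℝ (Fin d)) :
    f x₀ - f x ≤ initialGap f x₀ :=
  sub_le_sub_left (ciInf_le hf.bddBelow x) _

/-- A gradient step of size `1 / L` lowers `f` by at least `‖∇f(x₀)‖² / (2L)` and cannot pass below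
the infimum. -/
lemma norm_gradient_le (hf : IsSmoothObjective f L) (hL : 0 < L) (x₀ : EuclideanSpace ℝ (Fin d)) :
    ‖gradient f x₀‖ ≤ √(2 * L * initialGap f x₀) := by
  apply Real.le_sqrt_of_sq_le
  have h1 := hf.le_quadratic x₀ (-(1 / L) • gradient f x₀)
  have h2 := hf.sub_le_initialGap x₀ (x₀ + -(1 / L) • gradient f x₀)
  rw [inner_smul_right, real_inner_self_eq_norm_sq, norm_smul, mul_pow, Real.norm_eq_abs,
    sq_abs] at h1
  have h3 : L / 2 * ((-(1 / L)) ^ 2 * ‖gradient f x₀‖ ^ 2) = 1 / (2 * L) * ‖gradient f x₀‖ ^ 2 := by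
    field_simp
  rw [h3] at h1
  have h4 : 1 / (2 * L) * ‖gradient f x₀‖ ^ 2 ≤ initialGap f x₀ := by
    have : 1 / L = 2 * (1 / (2 * L)) := by field_simp
    rw [this] at h1 h2
    linarith
  calc ‖gradient f x₀‖ ^ 2 = 2 * L * (1 / (2 * L) * ‖gradient f x₀‖ ^ 2) := by field_simp
    _ ≤ _ := by gcongr

/-- One normalized step along an approximation `v` of the gradient. -/
lemma normalized_step (hf : IsSmoothObjective f L) (hL : 0 ≤ L) {η : ℝ} (hη : 0 ≤ η)
    (x v : EuclideanSpace ℝ (Fin d)) :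
    f (x - (η / ‖v‖) • v) ≤
      f x - η * ‖gradient f x‖ + 2 * η * ‖v - gradient f x‖ + L / 2 * η ^ 2 := by
  have h := hf.le_quadratic x (-(η / ‖v‖) • v)
  rw [neg_smul, ← sub_eq_add_neg, inner_neg_right, inner_smul_right, norm_neg, norm_smul,
    Real.norm_of_nonneg (by positivity)] at h
  rcases eq_or_ne v 0 with rfl | hv
  -- For `v = 0` the point stays put, and the error term `2 η ‖∇f(x)‖` outweighs the claimed
  -- decrease `η ‖∇f(x)‖`.
  · simp at h ⊢
    nlinarith [norm_nonneg (gradient f x), mul_nonneg hη (norm_nonneg (gradient f x)),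
      mul_nonneg hL (sq_nonneg η)]
  have hv' : 0 < ‖v‖ := norm_pos_iff.mpr hv
  rw [div_mul_cancel₀ _ hv'.ne'] at h
  have h1 : inner ℝ (gradient f x) v = ‖v‖ ^ 2 - inner ℝ (v - gradient f x) v := by
    rw [inner_sub_left, real_inner_self_eq_norm_sq]; ring
  have h2 := real_inner_le_norm (v - gradient f x) v
  have h3 : ‖gradient f x‖ ≤ ‖v‖ + ‖v - gradient f x‖ := by
    calc ‖gradient f x‖ = ‖v - (v - gradient f x)‖ := by rw [sub_sub_cancel]
      _ ≤ _ := norm_sub_le _ _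
  have h4 : η / ‖v‖ * (‖v‖ ^ 2 - ‖v - gradient f x‖ * ‖v‖) ≤
      η / ‖v‖ * inner ℝ (gradient f x) v := by
    gcongr; linarith
  have h5 : η / ‖v‖ * (‖v‖ ^ 2 - ‖v - gradient f x‖ * ‖v‖) = η * (‖v‖ - ‖v - gradient f x‖) := by
    field_simp
  have h6 : η * ‖gradient f x‖ ≤ η * (‖v‖ + ‖v - gradient f x‖) := by gcongr
  linarith

end IsSmoothObjective

/-! ### Deterministic execution: progress and wall-clock time. -/

namespace RState

variable {n d : ℕ} {K R : ℕ} {η β : ℝ}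

/-- The server applies an update when worker `i` delivers. -/
def Accepts (K R : ℕ) (S : RState n d) (i : Fin n) : Prop :=
  S.k < K ∧ S.k - S.stamp i < R

instance (K R : ℕ) (S : RState n d) (i : Fin n) : Decidable (Accepts K R S i) :=
  inferInstanceAs (Decidable (_ ∧ _))

section Step

variable (S : RState n d) (i : Fin n) (g : EuclideanSpace ℝ (Fin d)) (h : ℝ)

lemma step_of_not_lt (hk : ¬ S.k < K) : S.step K R η β i g h = S := if_neg hk

lemma step_k : (S.step K R η β i g h).k = if Accepts K R S i then S.k + 1 else S.k := by
  by_cases hk : S.k < K <;> by_cases hd : S.k - S.stamp i < R <;>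
    simp [step, Accepts, update, hk, hd]

lemma step_iter : (S.step K R η β i g h).iter =
    if Accepts K R S i then (S.update η β g).iter else S.iter := by
  by_cases hk : S.k < K <;> by_cases hd : S.k - S.stamp i < R <;>
    simp [step, Accepts, update, hk, hd]

lemma step_v : (S.step K R η β i g h).v =
    if Accepts K R S i then (if S.k ≤ 1 then 0 else β) • S.v + (1 - β) • g else S.v := by
  by_cases hk : S.k < K <;> by_cases hd : S.k - S.stamp i < R <;>
    simp [step, Accepts, update, hk, hd]

lemma step_stamp : (S.step K R η β i g h).stamp =
    if S.k < K then Function.update S.stamp i (S.step K R η β i g h).k else S.stamp := by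
  unfold step update
  split_ifs <;> rfl

lemma step_point : (S.step K R η β i g h).point =
    if S.k < K then
      Function.update S.point i ((S.step K R η β i g h).iter (S.step K R η β i g h).k)
    else S.point := by
  unfold step update
  split_ifs <;> rfl

lemma step_clock : (S.step K R η β i g h).clock = if S.k < K then S.finish i else S.clock := by
  unfold step
  split_ifs <;> rfl

lemma step_finish : (S.step K R η β i g h).finish =
    if S.k < K then Function.update S.finish i (S.finish i + h) else S.finish := by
  unfold step update
  split_ifs <;> rfl

end Step

/-- `S` is a sequence of states in which the `s`-th delivery is the gradient `g s` of worker `c s`,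
whose next computation takes time `h s`. -/
def IsTrace (K R : ℕ) (η β : ℝ) (c : ℕ → Fin n) (g : ℕ → EuclideanSpace ℝ (Fin d)) (h : ℕ → ℝ)
    (S : ℕ → RState n d) : Prop :=
  ∀ s, S (s + 1) = (S s).step K R η β (c s) (g s) (h s)

namespace IsTrace

variable {c : ℕ → Fin n} {g : ℕ → EuclideanSpace ℝ (Fin d)} {h : ℕ → ℝ} {S : ℕ → RState n d}

lemma k_succ (hS : IsTrace K R η β c g h S) (s : ℕ) :
    (S (s + 1)).k = if Accepts K R (S s) (c s) then (S s).k + 1 else (S s).k := by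
  rw [hS, step_k]

lemma monotone_k (hS : IsTrace K R η β c g h S) : Monotone fun s => (S s).k :=
  monotone_nat_of_le_succ fun s => by rw [hS.k_succ]; split_ifs <;> omega

lemma k_succ_le (hS : IsTrace K R η β c g h S) (s : ℕ) : (S (s + 1)).k ≤ (S s).k + 1 := by
  rw [hS.k_succ]; split_ifs <;> omega

lemma k_le (hS : IsTrace K R η β c g h S) (h0 : (S 0).k = 0) (s : ℕ) : (S s).k ≤ K := by
  induction s with
  | zero => omega
  | succ s ih =>
    rw [hS.k_succ]
    split_ifs with ha
    · exact ha.1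
    · exact ih

lemma stamp_succ (hS : IsTrace K R η β c g h S) {s : ℕ} (hk : (S s).k < K) :
    (S (s + 1)).stamp = Function.update (S s).stamp (c s) (S (s + 1)).k := by
  rw [hS s, step_stamp, if_pos hk]

lemma frozen (hS : IsTrace K R η β c g h S) {s : ℕ} (hk : ¬ (S s).k < K) {t : ℕ} (hst : s ≤ t) :
    S t = S s := by
  induction t, hst using Nat.le_induction with
  | base => rfl
  | succ t hst ih => rw [hS, step_of_not_lt _ _ _ _ (by rwa [ih]), ih]

/-- Among `n + 1` consecutive deliveries some worker delivers twice, and its second delivery is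
accepted unless an update has been made before. -/
lemma lt_k_add (hS : IsTrace K R η β c g h S) (hR : 0 < R) {s : ℕ} (hk : (S s).k < K) :
    (S s).k < (S (s + (n + 1))).k := by
  by_contra! hle
  have hconst : ∀ t, s ≤ t → t ≤ s + (n + 1) → (S t).k = (S s).k := fun t h1 h2 =>
    le_antisymm ((hS.monotone_k h2).trans hle) (hS.monotone_k h1)
  obtain ⟨a, b, hab, heq⟩ := Fintype.exists_ne_map_eq_of_card_lt
    (fun a : Fin (n + 1) => c (s + a)) (by simp)
  wlog hlt : a < b generalizing a b
  · exact this b a hab.symm heq.symm (lt_of_le_of_ne (not_lt.mp hlt) hab.symm)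
  have hlt' : (a : ℕ) < b := hlt
  have hb := b.isLt
  have hstamp : ∀ t, s + a + 1 ≤ t → t ≤ s + b → (S t).stamp (c (s + a)) = (S s).k := by
    intro t ht
    induction t, ht using Nat.le_induction with
    | base =>
      intro _
      rw [hS.stamp_succ (by rw [hconst _ (by omega) (by omega)]; exact hk), Function.update_self]
      exact hconst _ (by omega) (by omega)
    | succ t ht ih =>
      intro htb
      rw [hS.stamp_succ (by rw [hconst _ (by omega) (by omega)]; exact hk), Function.update_apply]
      split_ifs
      · exact hconst _ (by omega) (by omega)
      · exact ih (by omega)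
  have h1 := hstamp (s + b) (by omega) le_rfl
  have h2 := hconst (s + b) (by omega) (by omega)
  have h3 := hconst (s + b + 1) (by omega) (by omega)
  rw [hS.k_succ, if_pos] at h3
  · omega
  · refine ⟨by omega, ?_⟩
    have : c (s + b) = c (s + a) := heq.symm
    rw [this, h1, h2]
    omega

/-- Every block of `n + 1` deliveries contains an update. The index `K * (n + 1)` is the same for
all sample paths, so a fixed time can later replace the random stopping time. -/
lemma k_eq_of_le (hS : IsTrace K R η β c g h S) (hR : 0 < R) (h0 : (S 0).k = 0) :
    (S (K * (n + 1))).k = K := by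
  have : ∀ j, j ≤ K → j ≤ (S (j * (n + 1))).k := by
    intro j
    induction j with
    | zero => omega
    | succ j ih =>
      intro hj
      have h1 := ih (by omega)
      have h2 : j * (n + 1) + (n + 1) = (j + 1) * (n + 1) := by ring
      by_cases hk : (S (j * (n + 1))).k < K
      · have h3 := hS.lt_k_add hR hk
        rw [h2] at h3
        omega
      · have h3 := hS.monotone_k (show j * (n + 1) ≤ (j + 1) * (n + 1) by rw [← h2]; omega)
        simp only at h3
        omega
  exact le_antisymm (hS.k_le h0 _) (this K le_rfl)

variable {τ : Fin n → ℝ}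

/-- Every pending computation started no later than the current clock. The upper bound allows an
epoch to be started at any moment. -/
lemma clock_le_finish (hS : IsTrace K R η β c g h S) (h0 : (S 0).clock = 0)
    (hf0 : ∀ i, 0 ≤ (S 0).finish i) (hf1 : ∀ i, (S 0).finish i ≤ τ i)
    (hh0 : ∀ s, 0 ≤ h s) (hh1 : ∀ s, h s ≤ τ (c s))
    (hc : ∀ s i, (S s).finish (c s) ≤ (S s).finish i) (s : ℕ) (i : Fin n) :
    (S s).clock ≤ (S s).finish i ∧ (S s).finish i ≤ (S s).clock + τ i := by
  induction s generalizing i with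
  | zero => rw [h0, zero_add]; exact ⟨hf0 i, hf1 i⟩
  | succ s ih =>
    rw [hS s, step_clock, step_finish]
    split_ifs
    · rw [Function.update_apply]
      split_ifs with hi
      · subst hi
        exact ⟨by linarith [hh0 s], by linarith [hh1 s]⟩
      · exact ⟨hc s i, by linarith [(ih i).2, (ih (c s)).1]⟩
    · exact ih i

/-- In `R` consecutive updates each worker delivers at most one stale gradient. -/
lemma exists_delivery_counts (hS : IsTrace K R η β c g h S)
    (hh1 : ∀ s, h s ≤ τ (c s)) {s₁ : ℕ}
    (hfin : ∀ i, (S s₁).finish i ≤ (S s₁).clock + τ i) {s : ℕ} (hs : s₁ ≤ s)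
    (hkR : (S s).k < (S s₁).k + R) (hk : (S s).k < K) :
    ∃ N : Fin n → ℕ, (∀ i, (S s).finish i ≤ (S s₁).clock + (N i + 1) * τ i) ∧
      (S s₁).k + ∑ i, (N i - 1) ≤ (S s).k ∧ ∀ i, 1 ≤ N i → (S s₁).k ≤ (S s).stamp i := by
  induction s, hs using Nat.le_induction with
  -- `N i` counts the deliveries of worker `i` since `s₁`. The truncated `N i - 1` leaves out the
  -- first one, whose stamp may be old; every later one carries a stamp of at least `(S s₁).k`,
  -- hence has delay below `R` and is accepted.
  | base => exact ⟨fun _ => 0, fun i => by simpa using hfin i, by simp, by simp⟩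
  | succ s hs ih =>
    have hmono := hS.monotone_k (Nat.le_succ s)
    have hmono' := hS.monotone_k hs
    simp only [Nat.succ_eq_add_one] at hmono hmono'
    have hks : (S s).k < K := by omega
    obtain ⟨N, h1, h2, h3⟩ := ih (by omega) hks
    refine ⟨Function.update N (c s) (N (c s) + 1), fun i => ?_, ?_, fun i hi => ?_⟩
    · rw [hS s, step_finish, if_pos hks]
      simp only [Function.update_apply]
      split_ifs with hi
      · subst hi
        push_cast
        linarith [h1 (c s), hh1 s]
      · exact h1 i
    · have hsum : ∑ i, (Function.update N (c s) (N (c s) + 1) i - 1) =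
          ∑ i, (N i - 1) + if 1 ≤ N (c s) then 1 else 0 := by
        rw [← Finset.add_sum_erase _ _ (Finset.mem_univ (c s)),
          ← Finset.add_sum_erase (a := c s) _ (fun i => N i - 1) (Finset.mem_univ (c s)),
          Finset.sum_congr rfl fun i hi => by
            rw [Function.update_of_ne (Finset.ne_of_mem_erase hi)],
          Function.update_self]
        split_ifs <;> omega
      rw [hsum]
      split_ifs with hN
      · have hst := h3 _ hN
        rw [hS.k_succ, if_pos ⟨hks, by omega⟩]
        omega
      · omega
    · rw [hS.stamp_succ hks]
      simp only [Function.update_apply] at hi ⊢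
      split_ifs with hic
      · omega
      · rw [if_neg hic] at hi
        exact h3 i hi

/-- `R` consecutive updates, started at any moment, take time at most `(R + 2 |A|) / ∑_A 1 / τ`. -/
lemma clock_succ_le_add (hS : IsTrace K R η β c g h S) (hτ : ∀ i, 0 < τ i)
    (hh1 : ∀ s, h s ≤ τ (c s)) (hc : ∀ s i, (S s).finish (c s) ≤ (S s).finish i) {s₁ : ℕ}
    (hfin : ∀ i, (S s₁).finish i ≤ (S s₁).clock + τ i) {s : ℕ} (hs : s₁ ≤ s)
    (hkR : (S s).k < (S s₁).k + R) (hk : (S s).k < K) {A : Finset (Fin n)} (hA : A.Nonempty) :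
    (S (s + 1)).clock ≤ (S s₁).clock + (R + 2 * A.card) / ∑ i ∈ A, 1 / τ i := by
  obtain ⟨N, h1, h2, -⟩ := hS.exists_delivery_counts hh1 hfin hs hkR hk
  rw [hS s, step_clock, if_pos hk]
  have hpos : 0 < ∑ i ∈ A, 1 / τ i := Finset.sum_pos (fun i _ => by have := hτ i; positivity) hA
  rw [← sub_le_iff_le_add', le_div_iff₀ hpos, Finset.mul_sum]
  set F := (S s).finish (c s) - (S s₁).clock with hF
  -- The next delivery is the earliest, so its time `F` after the start of the epoch is at most `(N
  -- i + 1) * τ i` for all workers simultaneously.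
  have h3 : ∀ i, F * (1 / τ i) ≤ ((N i - 1 : ℕ) : ℝ) + 2 := by
    intro i
    have h4 := (hc s i).trans (h1 i)
    have h5 : F ≤ (N i + 1) * τ i := by linarith
    have h6 : (N i : ℝ) ≤ ((N i - 1 : ℕ) : ℝ) + 1 := by norm_cast; omega
    rw [mul_one_div, div_le_iff₀ (hτ i)]
    nlinarith [hτ i]
  calc ∑ i ∈ A, F * (1 / τ i) ≤ ∑ i ∈ A, (((N i - 1 : ℕ) : ℝ) + 2) :=
        Finset.sum_le_sum fun i _ => h3 i
    _ = ((∑ i ∈ A, (N i - 1) : ℕ) : ℝ) + 2 * A.card := by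
        rw [Finset.sum_add_distrib]; push_cast; simp; ring
    _ ≤ R + 2 * A.card := by
        have : ∑ i ∈ A, (N i - 1) ≤ ∑ i, (N i - 1) :=
          Finset.sum_le_sum_of_subset (Finset.subset_univ A)
        gcongr
        omega

/-- The updates are cut into epochs of `R`, and the epoch bound is applied to each of the first `j +
1` of them. -/
lemma clock_succ_le (hS : IsTrace K R η β c g h S) (hR : 0 < R) (hτ : ∀ i, 0 < τ i)
    (hk0 : (S 0).k = 0) (h0 : (S 0).clock = 0)
    (hf0 : ∀ i, 0 ≤ (S 0).finish i) (hf1 : ∀ i, (S 0).finish i ≤ τ i)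
    (hh0 : ∀ s, 0 ≤ h s) (hh1 : ∀ s, h s ≤ τ (c s))
    (hc : ∀ s i, (S s).finish (c s) ≤ (S s).finish i)
    {A : Finset (Fin n)} (hA : A.Nonempty) (j : ℕ) {s : ℕ}
    (hkR : (S s).k < (j + 1) * R) (hk : (S s).k < K) :
    (S (s + 1)).clock ≤ (j + 1) * ((R + 2 * A.card) / ∑ i ∈ A, 1 / τ i) := by
  have hfin := fun s i => (hS.clock_le_finish h0 hf0 hf1 hh0 hh1 hc s i).2
  have hB : 0 ≤ (R + 2 * A.card : ℝ) / ∑ i ∈ A, 1 / τ i := by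
    have : 0 ≤ ∑ i ∈ A, 1 / τ i := Finset.sum_nonneg fun i _ => by have := hτ i; positivity
    positivity
  induction j generalizing s with
  | zero =>
    have := hS.clock_succ_le_add hτ hh1 hc (hfin 0) (Nat.zero_le s) (by omega) hk hA
    simpa [h0] using this
  | succ j ih =>
    by_cases hlt : (S s).k < (j + 1) * R
    · refine (ih hlt hk).trans ?_
      gcongr
      simp
    have hex : ∃ t, (j + 1) * R ≤ (S t).k := ⟨s, not_lt.mp hlt⟩
    classical
    -- Delivery `t` makes update number `(j + 1) * R`. It is still covered by the induction
    -- hypothesis, and the next epoch starts at `t + 1`.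
    obtain ⟨t, ht⟩ : ∃ t, Nat.find hex = t + 1 := by
      refine Nat.exists_eq_succ_of_ne_zero fun hz => ?_
      have h1 := Nat.find_spec hex
      rw [hz, hk0] at h1
      have : 0 < (j + 1) * R := by positivity
      omega
    have h1 := Nat.find_spec hex
    have h2 := Nat.find_min hex (m := t) (by omega)
    have h3 : Nat.find hex ≤ s := Nat.find_min' hex (not_lt.mp hlt)
    rw [ht] at h1 h3
    have h4 := hS.k_succ_le t
    have h5 := hS.monotone_k (show t ≤ s by omega)
    simp only at h5
    have h6 : (j + 1 + 1) * R = (j + 1) * R + R := by ring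
    have h7 := ih (s := t) (by omega) (by omega)
    have h8 := hS.clock_succ_le_add hτ hh1 hc (hfin (t + 1)) h3 (by omega) hk hA
    push_cast
    linarith

end IsTrace

variable {Ξ : Type*} (G : EuclideanSpace ℝ (Fin d) → Ξ → EuclideanSpace ℝ (Fin d))
  (x₀ : EuclideanSpace ℝ (Fin d)) (c : ℕ → Fin n) (z : ℕ → Ξ) (h : ℕ → Fin n → ℝ)

lemma isTrace_run (K R : ℕ) (η β : ℝ) : IsTrace K R η β c
    (fun s => G ((run G K R η β x₀ c z h s).point (c s)) (z s)) (fun s => h (s + 1) (c s))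
    (run G K R η β x₀ c z h) := fun _ => rfl

/-- After the stop the state is frozen, so it can be read off at a deterministic index;
measurability of the output then needs no stopping times. -/
lemma final_eq_run (hR : 0 < R) :
    final G K R η β x₀ c z h = run G K R η β x₀ c z h (K * (n + 1)) := by
  have hS := isTrace_run G x₀ c z h K R η β
  have hmem : K * (n + 1) ∈ {s | ¬ (run G K R η β x₀ c z h s).k < K} := by
    simp [hS.k_eq_of_le hR rfl]
  exact (hS.frozen (Nat.sInf_mem ⟨_, hmem⟩) (Nat.sInf_le hmem)).symm

lemma final_k (hR : 0 < R) : (final G K R η β x₀ c z h).k = K := by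
  rw [final_eq_run G x₀ c z h hR]
  exact (isTrace_run G x₀ c z h K R η β).k_eq_of_le hR rfl

lemma final_clock_le (hK : 0 < K) (hR : 0 < R) {τ : Fin n → ℝ} (hτ : ∀ i, 0 < τ i)
    (hh0 : ∀ s i, 0 ≤ h s i) (hh1 : ∀ s i, h s i ≤ τ i)
    (hc : ∀ s i, (run G K R η β x₀ c z h s).finish (c s) ≤ (run G K R η β x₀ c z h s).finish i)
    {A : Finset (Fin n)} (hA : A.Nonempty) :
    (final G K R η β x₀ c z h).clock ≤
      ((K - 1) / R + 1) * ((R + 2 * A.card) / ∑ i ∈ A, 1 / τ i) := by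
  have hS := isTrace_run G x₀ c z h K R η β
  have hne : {s | ¬ (run G K R η β x₀ c z h s).k < K}.Nonempty :=
    ⟨K * (n + 1), by simp [hS.k_eq_of_le hR rfl]⟩
  -- Delivery `t` is the last processed one. Before it at most `K - 1` updates have been made, so it
  -- falls into epoch `k / R`, counted from `0`.
  obtain ⟨t, ht⟩ : ∃ t, sInf {s | ¬ (run G K R η β x₀ c z h s).k < K} = t + 1 := by
    refine Nat.exists_eq_succ_of_ne_zero fun hz => ?_
    have h1 := Nat.sInf_mem hne
    rw [hz] at h1
    exact h1 hK
  have hkt : (run G K R η β x₀ c z h t).k < K := by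
    by_contra hcon
    have := Nat.sInf_le (s := {s | ¬ (run G K R η β x₀ c z h s).k < K}) (m := t) hcon
    omega
  set k := (run G K R η β x₀ c z h t).k
  have h1 := hS.clock_succ_le hR hτ rfl rfl (fun i => hh0 0 i) (fun i => hh1 0 i)
    (fun s => hh0 _ _) (fun s => hh1 _ _) hc hA (k / R) (s := t)
    (by rw [mul_comm]; exact Nat.lt_mul_div_succ _ hR) hkt
  unfold final
  rw [ht]
  refine h1.trans ?_
  have hB : 0 ≤ (R + 2 * A.card : ℝ) / ∑ i ∈ A, 1 / τ i := by
    have : 0 ≤ ∑ i ∈ A, 1 / τ i := Finset.sum_nonneg fun i _ => by have := hτ i; positivity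
    positivity
  gcongr
  refine Nat.cast_div_le.trans ?_
  gcongr
  rw [le_sub_iff_add_le]
  exact_mod_cast hkt

end RState

/-! ### Pathwise convergence: bias of the momentum and summed descent. -/

namespace RState

variable {n d : ℕ} {K R : ℕ} {η β : ℝ}

/-- The part of the momentum vector that comes from the noise vectors `e s` of the accepted
gradients. -/
def noisePart (K R : ℕ) (β : ℝ) (S : ℕ → RState n d) (c : ℕ → Fin n)
    (e : ℕ → EuclideanSpace ℝ (Fin d)) : ℕ → EuclideanSpace ℝ (Fin d)
  | 0 => 0
  | s + 1 =>
    if Accepts K R (S s) (c s) then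
      (if (S s).k ≤ 1 then 0 else β) • noisePart K R β S c e s + (1 - β) • e s
    else noisePart K R β S c e s

namespace IsTrace

variable {c : ℕ → Fin n} {g : ℕ → EuclideanSpace ℝ (Fin d)} {h : ℕ → ℝ} {S : ℕ → RState n d}

lemma iter_succ_of_not (hS : IsTrace K R η β c g h S) {s : ℕ}
    (ha : ¬ Accepts K R (S s) (c s)) : (S (s + 1)).iter = (S s).iter := by
  rw [hS, step_iter, if_neg ha]

lemma v_succ (hS : IsTrace K R η β c g h S) {s : ℕ} (ha : Accepts K R (S s) (c s)) :
    (S (s + 1)).v = (if (S s).k ≤ 1 then 0 else β) • (S s).v + (1 - β) • g s := by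
  rw [hS, step_v, if_pos ha]

lemma iter_succ (hS : IsTrace K R η β c g h S) {s : ℕ} (ha : Accepts K R (S s) (c s)) :
    (S (s + 1)).iter = Function.update (S s).iter ((S s).k + 1)
      ((S s).iter (S s).k - (η / ‖(S (s + 1)).v‖) • (S (s + 1)).v) := by
  rw [hS.v_succ ha, hS, step_iter, if_pos ha]
  rfl

lemma iter_succ_of_le (hS : IsTrace K R η β c g h S) (s : ℕ) {j : ℕ} (hj : j ≤ (S s).k) :
    (S (s + 1)).iter j = (S s).iter j := by
  by_cases ha : Accepts K R (S s) (c s)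
  · rw [hS.iter_succ ha, Function.update_of_ne (by omega)]
  · rw [hS.iter_succ_of_not ha]

/-- Entries not yet written keep their initial value. This bounds the gradient at every index `j`,
also beyond `K`. -/
lemma iter_of_lt (hS : IsTrace K R η β c g h S) (s : ℕ) {j : ℕ}
    (hj : (S s).k < j) : (S s).iter j = (S 0).iter j := by
  induction s with
  | zero => rfl
  | succ s ih =>
    have hk := hS.k_succ s
    by_cases ha : Accepts K R (S s) (c s)
    · rw [if_pos ha] at hk
      rw [hS.iter_succ ha, Function.update_of_ne (by omega), ih (by omega)]
    · rw [if_neg ha] at hk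
      rw [hS.iter_succ_of_not ha, ih (by omega)]

lemma iter_zero (hS : IsTrace K R η β c g h S) (s : ℕ) : (S s).iter 0 = (S 0).iter 0 := by
  induction s with
  | zero => rfl
  | succ s ih => rw [hS.iter_succ_of_le s (Nat.zero_le _), ih]

lemma stamp_le (hS : IsTrace K R η β c g h S) (h0 : ∀ i, (S 0).stamp i = 0) (s : ℕ) (i : Fin n) :
    (S s).stamp i ≤ (S s).k := by
  induction s with
  | zero => simp [h0]
  | succ s ih =>
    have hmono := hS.monotone_k (Nat.le_succ s)
    simp only [Nat.succ_eq_add_one] at hmono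
    by_cases hk : (S s).k < K
    · rw [hS.stamp_succ hk, Function.update_apply]
      split_ifs
      · exact le_rfl
      · omega
    · rw [hS.frozen hk (Nat.le_succ s)]; exact ih

lemma point_eq (hS : IsTrace K R η β c g h S) (h0 : ∀ i, (S 0).stamp i = 0)
    (hp0 : ∀ i, (S 0).point i = (S 0).iter 0) (s : ℕ) (i : Fin n) :
    (S s).point i = (S s).iter ((S s).stamp i) := by
  induction s with
  | zero => rw [h0, hp0]
  | succ s ih =>
    by_cases hk : (S s).k < K
    · have hpt : (S (s + 1)).point =
          Function.update (S s).point (c s) ((S (s + 1)).iter (S (s + 1)).k) := by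
        rw [hS s, step_point, if_pos hk]
      rw [hS.stamp_succ hk, hpt, Function.update_apply, Function.update_apply]
      split_ifs
      · rfl
      · rw [hS.iter_succ_of_le s (hS.stamp_le h0 s i), ih]
    · rw [hS.frozen hk (Nat.le_succ s)]; exact ih

/-- Normalization bounds the movement whatever the noise does, so the cost of a delay is
deterministic. -/
lemma norm_iter_succ_sub_le (hS : IsTrace K R η β c g h S) (hη : 0 ≤ η)
    (hk0 : (S 0).k = 0) (s : ℕ) {j : ℕ}
    (hj : j < (S s).k) : ‖(S s).iter (j + 1) - (S s).iter j‖ ≤ η := by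
  induction s with
  | zero => omega
  | succ s ih =>
    by_cases ha : Accepts K R (S s) (c s)
    · have hk := hS.k_succ s
      rw [if_pos ha] at hk
      rw [hS.iter_succ_of_le s (j := j) (by omega)]
      rcases lt_or_eq_of_le (show j ≤ (S s).k by omega) with hlt | rfl
      · rw [hS.iter_succ_of_le s (j := j + 1) (by omega)]
        exact ih hlt
      · rw [hS.iter_succ ha, Function.update_self, sub_sub_cancel_left, norm_neg, norm_smul,
          Real.norm_of_nonneg (by positivity)]
        rcases eq_or_ne ‖(S (s + 1)).v‖ 0 with hv | hv
        · rw [hv, mul_zero]; exact hη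
        · rw [div_mul_cancel₀ _ hv]
    · have hk := hS.k_succ s
      rw [if_neg ha] at hk
      rw [hS.iter_succ_of_not ha]
      exact ih (by omega)

lemma norm_iter_sub_le (hS : IsTrace K R η β c g h S) (hη : 0 ≤ η)
    (hk0 : (S 0).k = 0) (s : ℕ) {i j : ℕ}
    (hij : i ≤ j) (hj : j ≤ (S s).k) : ‖(S s).iter j - (S s).iter i‖ ≤ η * (j - i : ℕ) := by
  induction j, hij using Nat.le_induction with
  | base => simp
  | succ j hij ih =>
    have h1 := ih (by omega)
    have h2 := hS.norm_iter_succ_sub_le hη hk0 s (show j < (S s).k by omega)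
    have h3 := norm_sub_le_norm_sub_add_norm_sub ((S s).iter (j + 1)) ((S s).iter j) ((S s).iter i)
    rw [Nat.sub_add_comm hij]
    push_cast
    linarith

section Convergence

variable {f : EuclideanSpace ℝ (Fin d) → ℝ} {L : ℝ}

lemma norm_gradient_sub_le (hS : IsTrace K R η β c g h S) (hf : IsSmoothObjective f L) (hL : 0 ≤ L)
    (hη : 0 ≤ η) (hk0 : (S 0).k = 0) (s : ℕ) {i j m : ℕ}
    (hij : i ≤ j) (hj : j ≤ (S s).k) (hm : j - i ≤ m) :
    ‖gradient f ((S s).iter i) - gradient f ((S s).iter j)‖ ≤ m * (L * η) := by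
  have h1 := hf.lipschitz_gradient ((S s).iter j) ((S s).iter i)
  have h2 := hS.norm_iter_sub_le hη hk0 s hij hj
  rw [norm_sub_rev]
  calc _ ≤ L * (η * (j - i : ℕ)) := h1.trans (by gcongr)
    _ ≤ L * (η * m) := by gcongr
    _ = _ := by ring

/-- The noiseless part of the momentum follows the gradient. -/
lemma norm_bias_le (hS : IsTrace K R η β c g h S) (hf : IsSmoothObjective f L) (hL : 0 ≤ L)
    (hη : 0 ≤ η) (hβ₀ : 0 ≤ β) (hβ₁ : β < 1) (hR : 0 < R)
    (hk0 : (S 0).k = 0) (hs0 : ∀ i, (S 0).stamp i = 0)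
    (hp0 : ∀ i, (S 0).point i = (S 0).iter 0) {Q : ℝ} (hQ₀ : 0 ≤ Q)
    (hQ : β * (L * η) + (1 - β) * ((R - 1) * (L * η)) ≤ (1 - β) * Q) (s : ℕ)
    (hk : 1 ≤ (S s).k) :
    ‖(S s).v - noisePart K R β S c (fun t => g t - gradient f ((S t).point (c t))) s -
      gradient f ((S s).iter ((S s).k - 1))‖ ≤
      Q + β ^ ((S s).k - 1) * ‖gradient f ((S 0).iter 0)‖ := by
  set M := noisePart K R β S c (fun t => g t - gradient f ((S t).point (c t)))
  set g₀ := ‖gradient f ((S 0).iter 0)‖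
  have hLη : 0 ≤ L * η := by positivity
  have hβ' : 0 ≤ 1 - β := by linarith
  induction s with
  | zero => omega
  | succ s ih =>
    have hks := hS.k_succ s
    by_cases ha : Accepts K R (S s) (c s)
    · rw [if_pos ha] at hks
      have hM : M (s + 1) = (if (S s).k ≤ 1 then 0 else β) • M s +
          (1 - β) • (g s - gradient f ((S s).point (c s))) := by
        simp only [M, noisePart, if_pos ha]
      rw [hS.v_succ ha, hM, hks, Nat.add_sub_cancel, hS.iter_succ_of_le s le_rfl,
        hS.point_eq hs0 hp0]
      have hst := hS.stamp_le hs0 s (c s)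
      have hdel := hS.norm_gradient_sub_le hf hL hη hk0 s hst le_rfl (m := R - 1)
        (by have := ha.2; omega)
      rw [Nat.cast_pred hR] at hdel
      set y := gradient f ((S s).iter ((S s).stamp (c s)))
      set x := gradient f ((S s).iter (S s).k) with hx
      have hmain : ∀ (b : ℝ) (w : EuclideanSpace ℝ (Fin d)),
          b • (S s).v + (1 - β) • g s - (b • M s + (1 - β) • (g s - y)) - x = w →
          b • ((S s).v - M s) + (1 - β) • (y - x) - β • x = w := by
        rintro b w rfl
        module
      by_cases hk1 : (S s).k ≤ 1
      -- For `k ≤ 1` the old momentum is erased but the new gradient still has weight only `1 - β`.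
      -- The missing `β • x` is the source of the term with `‖∇f(x₀)‖`; it fits because `β ≤ β ^ k`
      -- for `k ≤ 1`.
      · rw [if_pos hk1, ← hmain 0 _ rfl, zero_smul, zero_add]
        have h1 : ‖x‖ ≤ (S s).k * (L * η) + g₀ := by
          have h2 := hS.norm_gradient_sub_le hf hL hη hk0 s (Nat.zero_le _) le_rfl
            (m := (S s).k) (by omega)
          rw [hS.iter_zero] at h2
          rw [← hx, norm_sub_rev] at h2
          have h3 := norm_le_norm_add_norm_sub' x (gradient f ((S 0).iter 0))
          linarith
        have h2 : ‖(1 - β) • (y - x) - β • x‖ ≤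
            (1 - β) * ‖y - x‖ + β * ‖x‖ := by
          refine (norm_sub_le _ _).trans_eq ?_
          rw [norm_smul, norm_smul, Real.norm_of_nonneg hβ₀, Real.norm_of_nonneg hβ']
        have h3 : (1 - β) * ‖y - x‖ ≤ (1 - β) * ((R - 1) * (L * η)) := by gcongr
        have h4 : β * ‖x‖ ≤ β * (L * η + g₀) := by
          have h5 : ((S s).k : ℝ) * (L * η) ≤ 1 * (L * η) :=
            mul_le_mul_of_nonneg_right (by exact_mod_cast hk1) hLη
          gcongr
          linarith
        have h5 : β * g₀ ≤ β ^ (S s).k * g₀ := by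
          gcongr
          rcases Nat.le_one_iff_eq_zero_or_eq_one.mp hk1 with h | h <;> rw [h] <;> simp [hβ₁.le]
        nlinarith
      · rw [if_neg hk1, ← hmain β _ rfl]
        have hih := ih (by omega)
        have hstep := hS.norm_gradient_sub_le hf hL hη hk0 s
          (show (S s).k - 1 ≤ (S s).k by omega) le_rfl (m := 1) (by omega)
        rw [Nat.cast_one, one_mul, ← hx] at hstep
        set w := gradient f ((S s).iter ((S s).k - 1))
        -- Damped old bias, drift of the gradient over one step, and staleness of the new gradient.
        -- By `hQ`, one more update does not raise the bound `Q`.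
        have h1 : β • ((S s).v - M s) + (1 - β) • (y - x) - β • x =
            β • ((S s).v - M s - w) + β • (w - x) + (1 - β) • (y - x) := by module
        rw [h1]
        have h2 := norm_add₃_le (a := β • ((S s).v - M s - w)) (b := β • (w - x))
          (c := (1 - β) • (y - x))
        rw [norm_smul, norm_smul, norm_smul, Real.norm_of_nonneg hβ₀, Real.norm_of_nonneg hβ'] at h2
        have h3 : β * ‖(S s).v - M s - w‖ ≤ β * (Q + β ^ ((S s).k - 1) * g₀) := by gcongr
        have h4 : β * ‖w - x‖ ≤ β * (L * η) := by gcongr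
        have h5 : (1 - β) * ‖y - x‖ ≤ (1 - β) * ((R - 1) * (L * η)) := by gcongr
        have h6 : β ^ (S s).k = β * β ^ ((S s).k - 1) := by
          rw [← pow_succ', Nat.sub_add_cancel (by omega)]
        rw [h6]
        nlinarith
    · rw [if_neg ha] at hks
      have hM : M (s + 1) = M s := by simp only [M, noisePart, if_neg ha]
      have hv : (S (s + 1)).v = (S s).v := by rw [hS, step_v, if_neg ha]
      rw [hM, hv, hks, hS.iter_succ_of_not ha]
      exact ih (by omega)

/-- Summed descent inequality for a trace. -/
lemma sum_norm_gradient_le (hS : IsTrace K R η β c g h S) (hf : IsSmoothObjective f L) (hL : 0 ≤ L)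
    (hη : 0 ≤ η) (hβ₀ : 0 ≤ β) (hβ₁ : β < 1) (hR : 0 < R)
    (hk0 : (S 0).k = 0) (hs0 : ∀ i, (S 0).stamp i = 0)
    (hp0 : ∀ i, (S 0).point i = (S 0).iter 0) {Q : ℝ} (hQ₀ : 0 ≤ Q)
    (hQ : β * (L * η) + (1 - β) * ((R - 1) * (L * η)) ≤ (1 - β) * Q) (s : ℕ) :
    η * ∑ j ∈ Finset.range (S s).k, ‖gradient f ((S s).iter j)‖ ≤
      f ((S 0).iter 0) - f ((S s).iter (S s).k) +
      2 * η * ((∑ t ∈ Finset.range s, if Accepts K R (S t) (c t) then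
          ‖noisePart K R β S c (fun t => g t - gradient f ((S t).point (c t))) (t + 1)‖ else 0) +
        (S s).k * Q + (∑ j ∈ Finset.range (S s).k, β ^ j) * ‖gradient f ((S 0).iter 0)‖) +
      (S s).k * (L / 2 * η ^ 2) := by
  induction s with
  | zero => simp [hk0]
  | succ s ih =>
    have hks := hS.k_succ s
    by_cases ha : Accepts K R (S s) (c s)
    · rw [if_pos ha] at hks
      have hbias := hS.norm_bias_le hf hL hη hβ₀ hβ₁ hR hk0 hs0 hp0 hQ₀ hQ (s + 1) (by omega)
      rw [Finset.sum_range_succ _ s, if_pos ha]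
      set M := noisePart K R β S c (fun t => g t - gradient f ((S t).point (c t)))
      rw [hks, Nat.add_sub_cancel, hS.iter_succ_of_le s le_rfl] at hbias
      rw [hks, Finset.sum_range_succ, Finset.sum_range_succ, hS.iter_succ_of_le s le_rfl,
        Finset.sum_congr rfl fun j hj => by
          rw [hS.iter_succ_of_le s (Finset.mem_range.mp hj).le]]
      have hstep := hf.normalized_step hL hη ((S s).iter (S s).k) (S (s + 1)).v
      have hit : (S (s + 1)).iter ((S s).k + 1) =
          (S s).iter (S s).k - (η / ‖(S (s + 1)).v‖) • (S (s + 1)).v := by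
        rw [hS.iter_succ ha, Function.update_self]
      rw [hit]
      set x := (S s).iter (S s).k
      have h1 : ‖(S (s + 1)).v - gradient f x‖ ≤
          ‖M (s + 1)‖ + (Q + β ^ (S s).k * ‖gradient f ((S 0).iter 0)‖) := by
        have h2 := norm_add_le (M (s + 1)) ((S (s + 1)).v - M (s + 1) - gradient f x)
        have h3 : M (s + 1) + ((S (s + 1)).v - M (s + 1) - gradient f x) =
            (S (s + 1)).v - gradient f x := by abel
        rw [h3] at h2
        linarith
      have h2 : 2 * η * ‖(S (s + 1)).v - gradient f x‖ ≤
          2 * η * (‖M (s + 1)‖ + (Q + β ^ (S s).k * ‖gradient f ((S 0).iter 0)‖)) := by gcongr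
      push_cast
      linarith
    · rw [if_neg ha] at hks
      rw [hks, hS.iter_succ_of_not ha, Finset.sum_range_succ _ s, if_neg ha, add_zero]
      exact ih

/-- Converts sums over deliveries into sums over updates. -/
lemma sum_accepts (hS : IsTrace K R η β c g h S) (hk0 : (S 0).k = 0) (s : ℕ) :
    (∑ t ∈ Finset.range s, if Accepts K R (S t) (c t) then (1 : ℝ) else 0) = (S s).k := by
  induction s with
  | zero => simp [hk0]
  | succ s ih =>
    rw [Finset.sum_range_succ, ih, hS.k_succ]
    split_ifs <;> simp

end Convergence

end IsTrace

end RState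

/-! ### Measurability and fresh samples. -/

lemma Measurable.apply_countable {Ω ι X : Type*} [MeasurableSpace Ω] [MeasurableSpace ι]
    [Countable ι] [MeasurableSingletonClass ι] [MeasurableSpace X] {F : ι → Ω → X} {c : Ω → ι}
    (hF : ∀ i, Measurable (F i)) (hc : Measurable c) : Measurable fun ω => F (c ω) ω :=
  (measurable_from_prod_countable_right (f := fun q : ι × Ω => F q.1 q.2) hF).comp
    (hc.prodMk measurable_id)

/-- Replacing a fresh sample by its law, conditionally on the past. -/
lemma lintegral_le_of_indepFun {Ω Ξ A : Type*} [MeasurableSpace Ω] [MeasurableSpace Ξ]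
    [MeasurableSpace A] {μ : Measure Ω} [IsProbabilityMeasure μ] {D : Measure Ξ}
    {W : Ω → A} {Z : Ω → Ξ} (hW : Measurable W) (hZ : Measurable Z) (hind : IndepFun W Z μ)
    (hlaw : μ.map Z = D) {H : A × Ξ → ENNReal} (hH : Measurable H) {Φ : A → ENNReal}
    (hle : ∀ a, ∫⁻ ξ, H (a, ξ) ∂D ≤ Φ a) :
    ∫⁻ ω, H (W ω, Z ω) ∂μ ≤ ∫⁻ ω, Φ (W ω) ∂μ := by
  have : IsProbabilityMeasure (μ.map Z) := Measure.isProbabilityMeasure_map hZ.aemeasurable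
  rw [← lintegral_map hH (hW.prodMk hZ), (indepFun_iff_map_prod_eq_prod_map_map hW.aemeasurable
    hZ.aemeasurable).mp hind, lintegral_prod _ hH.aemeasurable, hlaw]
  exact (lintegral_mono hle).trans (lintegral_map_le _ _)

namespace RState

variable {n d : ℕ}

/-- Measurability of all parts of a random state on which the updates depend. -/
structure MeasurableState {Ω : Type*} [MeasurableSpace Ω] (T : Ω → RState n d) : Prop where
  k : Measurable fun ω => (T ω).k
  iter : ∀ j, Measurable fun ω => (T ω).iter j
  v : Measurable fun ω => (T ω).v
  point : ∀ i, Measurable fun ω => (T ω).point i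
  stamp : ∀ i, Measurable fun ω => (T ω).stamp i

namespace MeasurableState

variable {Ω : Type*} {K R : ℕ} {η β : ℝ} {T : Ω → RState n d} {c : Ω → Fin n}
  {g : Ω → EuclideanSpace ℝ (Fin d)}

lemma mono {m₁ m₂ : MeasurableSpace Ω} (hm : m₁ ≤ m₂) (hT : @MeasurableState n d Ω m₁ T) :
    @MeasurableState n d Ω m₂ T :=
  @MeasurableState.mk n d Ω m₂ T ((@MeasurableState.k n d Ω m₁ T hT).mono hm le_rfl)
    (fun j => (@MeasurableState.iter n d Ω m₁ T hT j).mono hm le_rfl)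
    ((@MeasurableState.v n d Ω m₁ T hT).mono hm le_rfl)
    (fun i => (@MeasurableState.point n d Ω m₁ T hT i).mono hm le_rfl)
    (fun i => (@MeasurableState.stamp n d Ω m₁ T hT i).mono hm le_rfl)

variable [MeasurableSpace Ω]

lemma measurableSet_accepts (hT : MeasurableState T) (hc : Measurable c) :
    MeasurableSet {ω | Accepts K R (T ω) (c ω)} := by
  have hst : Measurable fun ω => (T ω).stamp (c ω) :=
    Measurable.apply_countable (F := fun i ω => (T ω).stamp i) hT.stamp hc
  have hd : Measurable fun ω => (T ω).k - (T ω).stamp (c ω) :=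
    (measurable_of_countable fun q : ℕ × ℕ => q.1 - q.2).comp (hT.k.prodMk hst)
  exact (measurableSet_lt hT.k measurable_const).inter (measurableSet_lt hd measurable_const)

lemma measurable_ite_k (hT : MeasurableState T) (b : ℝ) :
    Measurable fun ω => if (T ω).k ≤ 1 then 0 else b :=
  Measurable.ite (measurableSet_le hT.k measurable_const) measurable_const measurable_const

lemma step (hT : MeasurableState T) (hc : Measurable c) (hg : Measurable g) (h : Ω → ℝ) :
    MeasurableState fun ω => (T ω).step K R η β (c ω) (g ω) (h ω) := by
  have hA := hT.measurableSet_accepts (K := K) (R := R) hc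
  have hlt : MeasurableSet {ω | (T ω).k < K} := measurableSet_lt hT.k measurable_const
  have hk : Measurable fun ω => ((T ω).step K R η β (c ω) (g ω) (h ω)).k := by
    simp only [step_k]
    exact Measurable.ite hA (hT.k.add_const 1) hT.k
  have hv' : Measurable fun ω => (if (T ω).k ≤ 1 then 0 else β) • (T ω).v + (1 - β) • g ω :=
    ((hT.measurable_ite_k β).smul hT.v).add (hg.const_smul (1 - β))
  have hiter : ∀ j, Measurable fun ω => ((T ω).step K R η β (c ω) (g ω) (h ω)).iter j := by
    intro j
    simp only [step_iter, apply_ite (fun F : ℕ → EuclideanSpace ℝ (Fin d) => F j)]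
    refine Measurable.ite hA ?_ (hT.iter j)
    simp only [update, Function.update_apply]
    refine Measurable.ite (measurableSet_eq_fun measurable_const (hT.k.add_const 1)) ?_ (hT.iter j)
    exact (Measurable.apply_countable (F := fun i ω => (T ω).iter i) hT.iter hT.k).sub
      ((measurable_const.div hv'.norm).smul hv')
  refine ⟨hk, hiter, ?_, fun i => ?_, fun i => ?_⟩
  · simp only [step_v]
    exact Measurable.ite hA hv' hT.v
  · simp only [step_point, apply_ite (fun F : Fin n → EuclideanSpace ℝ (Fin d) => F i),
      Function.update_apply]
    refine Measurable.ite hlt (Measurable.ite (measurableSet_eq_fun measurable_const hc) ?_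
      (hT.point i)) (hT.point i)
    exact Measurable.apply_countable
      (F := fun j ω => ((T ω).step K R η β (c ω) (g ω) (h ω)).iter j) hiter hk
  · simp only [step_stamp, apply_ite (fun F : Fin n → ℕ => F i), Function.update_apply]
    exact Measurable.ite hlt (Measurable.ite (measurableSet_eq_fun measurable_const hc) hk
      (hT.stamp i)) (hT.stamp i)

end MeasurableState

end RState

/-! ### Moments of the momentum noise. -/

namespace IsFixedComputation

open RState

variable {n d : ℕ} {Ω Ξ : Type*} {mΩ : MeasurableSpace Ω} [MeasurableSpace Ξ]
    {μ : Measure Ω} {ℱ : Filtration ℕ mΩ} {D : Measure Ξ} {τ : Fin n → ℝ}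
    {G : EuclideanSpace ℝ (Fin d) → Ξ → EuclideanSpace ℝ (Fin d)}
    {K R : ℕ} {η β : ℝ} {x₀ : EuclideanSpace ℝ (Fin d)}
    {c : ℕ → Ω → Fin n} {z : ℕ → Ω → Ξ} {h : ℕ → Fin n → Ω → ℝ}
    {f : EuclideanSpace ℝ (Fin d) → ℝ}

lemma measurable_gradient (hrun : IsFixedComputation μ ℱ D τ G K R η β x₀ c z h)
    (hG : Measurable (Function.uncurry G)) {s : ℕ} {T : Ω → RState n d}
    (hT : @MeasurableState n d Ω (ℱ s) T) :
    Measurable[ℱ (s + 1)] fun ω => G ((T ω).point (c s ω)) (z s ω) := by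
  have hy : Measurable[ℱ s] fun ω => (T ω).point (c s ω) :=
    let _ := ℱ s
    Measurable.apply_countable (F := fun i ω => (T ω).point i) hT.point (hrun.worker_measurable s)
  let _ := ℱ (s + 1)
  exact hG.comp ((hy.mono (ℱ.mono (Nat.le_succ s)) le_rfl).prodMk (hrun.sample_measurable s))

lemma measurable_run (hrun : IsFixedComputation μ ℱ D τ G K R η β x₀ c z h)
    (hG : Measurable (Function.uncurry G)) (s : ℕ) :
    @MeasurableState n d Ω (ℱ s) fun ω =>
      run G K R η β x₀ (fun t => c t ω) (fun t => z t ω) (fun t j => h t j ω) s := by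
  induction s with
  | zero =>
    let _ := ℱ 0
    exact ⟨measurable_const, fun _ => measurable_const, measurable_const,
      fun _ => measurable_const, fun _ => measurable_const⟩
  | succ s ih =>
    have hle := ℱ.mono (Nat.le_succ s)
    have hg := hrun.measurable_gradient hG ih
    have hc := (hrun.worker_measurable s).mono hle le_rfl
    let _ := ℱ (s + 1)
    exact (ih.mono hle).step hc hg _

/-- The random noise part of the momentum after `s` deliveries. -/
def noise (f : EuclideanSpace ℝ (Fin d) → ℝ)
    (G : EuclideanSpace ℝ (Fin d) → Ξ → EuclideanSpace ℝ (Fin d)) (K R : ℕ) (η β : ℝ)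
    (x₀ : EuclideanSpace ℝ (Fin d)) (c : ℕ → Ω → Fin n) (z : ℕ → Ω → Ξ) (h : ℕ → Fin n → Ω → ℝ)
    (s : ℕ) (ω : Ω) : EuclideanSpace ℝ (Fin d) :=
  let S := run G K R η β x₀ (fun t => c t ω) (fun t => z t ω) (fun t j => h t j ω)
  noisePart K R β S (fun t => c t ω)
    (fun t => G ((S t).point (c t ω)) (z t ω) - gradient f ((S t).point (c t ω))) s

/-- The update with delivery `s` happens at the sample point `ω`. -/
def AcceptsAt (G : EuclideanSpace ℝ (Fin d) → Ξ → EuclideanSpace ℝ (Fin d)) (K R : ℕ) (η β : ℝ)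
    (x₀ : EuclideanSpace ℝ (Fin d)) (c : ℕ → Ω → Fin n) (z : ℕ → Ω → Ξ) (h : ℕ → Fin n → Ω → ℝ)
    (s : ℕ) (ω : Ω) : Prop :=
  Accepts K R (run G K R η β x₀ (fun t => c t ω) (fun t => z t ω) (fun t j => h t j ω) s) (c s ω)

instance (s : ℕ) (ω : Ω) : Decidable (AcceptsAt G K R η β x₀ c z h s ω) :=
  inferInstanceAs (Decidable (Accepts _ _ _ _))

lemma measurableSet_acceptsAt (hrun : IsFixedComputation μ ℱ D τ G K R η β x₀ c z h)
    (hG : Measurable (Function.uncurry G)) (s : ℕ) :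
    MeasurableSet[ℱ s] {ω | AcceptsAt G K R η β x₀ c z h s ω} := by
  have hT := hrun.measurable_run hG s
  have hc := hrun.worker_measurable s
  let _ := ℱ s
  exact hT.measurableSet_accepts hc

lemma measurable_noise (hrun : IsFixedComputation μ ℱ D τ G K R η β x₀ c z h)
    (hG : Measurable (Function.uncurry G)) (hf : Measurable (gradient f)) (s : ℕ) :
    Measurable[ℱ s] (noise f G K R η β x₀ c z h s) := by
  induction s with
  | zero => exact measurable_const
  | succ s ih =>
    have hle := ℱ.mono (Nat.le_succ s)
    have hT := hrun.measurable_run hG s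
    have hg := hrun.measurable_gradient hG hT
    have hc := (hrun.worker_measurable s).mono hle le_rfl
    have hA := hle _ (hrun.measurableSet_acceptsAt hG s)
    have ih' := ih.mono hle le_rfl
    have hT' := hT.mono hle
    let _ := ℱ (s + 1)
    refine Measurable.ite hA ?_ ih'
    have hy := Measurable.apply_countable hT'.point hc
    exact ((hT'.measurable_ite_k β).smul ih').add ((hg.sub (hf.comp hy)).const_smul (1 - β))

/-- One accepted gradient. -/
lemma lintegral_noise_succ_le [IsProbabilityMeasure μ] [IsProbabilityMeasure D]
    (hrun : IsFixedComputation μ ℱ D τ G K R η β x₀ c z h)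
    {L p σ : ℝ} (hf : IsSmoothObjective f L) (hG : IsPBCMOracle D f G p σ)
    (hp₁ : 1 < p) (hp₂ : p ≤ 2) (hσ : 0 ≤ σ) (hβ₀ : 0 ≤ β) (hβ₁ : β ≤ 1) (s : ℕ) :
    ∫⁻ ω, (if AcceptsAt G K R η β x₀ c z h s ω then
        ‖noise f G K R η β x₀ c z h (s + 1) ω‖ₑ ^ p else 0) ∂μ ≤
      ∫⁻ ω, (if AcceptsAt G K R η β x₀ c z h s ω then
        ENNReal.ofReal β * ‖noise f G K R η β x₀ c z h s ω‖ₑ ^ p +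
          ENNReal.ofReal (2 * (1 - β) ^ p * σ ^ p) else 0) ∂μ := by
  have hp : 0 < p := by linarith
  have hgrad := hf.continuous_gradient.measurable
  set M := noise f G K R η β x₀ c z h
  set S := fun s ω => run G K R η β x₀ (fun t => c t ω) (fun t => z t ω) (fun t j => h t j ω) s
  set w : Ω → ENNReal := fun ω => if AcceptsAt G K R η β x₀ c z h s ω then 1 else 0 with hw
  set u : Ω → EuclideanSpace ℝ (Fin d) := fun ω => (if (S s ω).k ≤ 1 then 0 else β) • M s ω with hu
  set y : Ω → EuclideanSpace ℝ (Fin d) := fun ω => (S s ω).point (c s ω) with hy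
  have hT := hrun.measurable_run hG.measurable s
  have hA := hrun.measurableSet_acceptsAt hG.measurable s
  have hM := hrun.measurable_noise hG.measurable hgrad s
  have hc := hrun.worker_measurable s
  -- Acceptance, the retained noise and the query point are all known before delivery `s`, hence
  -- jointly independent of its sample.
  have hW : Measurable[ℱ s] fun ω => (w ω, u ω, y ω) := by
    let _ := ℱ s
    exact (Measurable.ite hA measurable_const measurable_const).prodMk
      (((hT.measurable_ite_k β).smul hM).prodMk
        (Measurable.apply_countable (F := fun i ω => (S s ω).point i) hT.point hc))
  have hind : IndepFun (fun ω => (w ω, u ω, y ω)) (z s) μ := by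
    rw [IndepFun_iff_Indep]
    exact (indep_of_indep_of_le_right (hrun.sample_fresh s) hW.comap_le).symm
  have hz : Measurable (z s) := (hrun.sample_measurable s).mono (ℱ.le _) le_rfl
  have hen : ∀ ω, AcceptsAt G K R η β x₀ c z h s ω →
      M (s + 1) ω = u ω + (1 - β) • (G (y ω) (z s ω) - gradient f (y ω)) := fun ω ha => if_pos ha
  set H : (ENNReal × EuclideanSpace ℝ (Fin d) × EuclideanSpace ℝ (Fin d)) × Ξ → ENNReal :=
    fun q => q.1.1 * ‖q.1.2.1 + (1 - β) • (G q.1.2.2 q.2 - gradient f q.1.2.2)‖ₑ ^ p with hHdef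
  have hGm : Measurable fun q :
      (ENNReal × EuclideanSpace ℝ (Fin d) × EuclideanSpace ℝ (Fin d)) × Ξ => G q.1.2.2 q.2 :=
    hG.measurable.comp (measurable_fst.snd.snd.prodMk measurable_snd)
  have hH : Measurable H :=
    measurable_fst.fst.mul (((measurable_fst.snd.fst.add ((hGm.sub
      (hgrad.comp measurable_fst.snd.snd)).const_smul (1 - β))).enorm).pow_const p)
  have key := lintegral_le_of_indepFun (μ := μ) (hW.mono (ℱ.le s) le_rfl) hz hind
    (hrun.sample_law s) hH
    (Φ := fun q => q.1 * (‖q.2.1‖ₑ ^ p + ENNReal.ofReal (2 * (1 - β) ^ p * σ ^ p)))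
    (by
      rintro ⟨a, u, y⟩
      have hX : Integrable (fun ξ => G y ξ - gradient f y) D :=
        (hG.integrable y).sub (integrable_const _)
      simp only [hHdef]
      rw [lintegral_const_mul]
      · gcongr
        refine lintegral_enorm_add_rpow_le hp₁ hp₂ hσ hX ?_ (hG.moment_le y) u (by linarith)
        rw [integral_sub (hG.integrable y) (integrable_const _), hG.unbiased]
        simp
      · have : Measurable (G y) := hG.measurable.comp measurable_prodMk_left
        exact ((((this.sub_const _).const_smul (1 - β)).const_add u).enorm).pow_const p)
  calc _ = ∫⁻ ω, H ((w ω, u ω, y ω), z s ω) ∂μ := by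
        refine lintegral_congr fun ω => ?_
        simp only [hHdef, hw]
        split_ifs with ha
        · rw [one_mul, hen ω ha]
        · rw [zero_mul]
    _ ≤ _ := key
    _ ≤ _ := by
        refine lintegral_mono fun ω => ?_
        simp only [hw]
        split_ifs with ha
        · rw [one_mul]
          gcongr
          simp only [hu]
          split_ifs
          · simp [ENNReal.zero_rpow_of_pos hp]
          · rw [enorm_smul, ENNReal.mul_rpow_of_nonneg _ _ hp.le]
            gcongr
            rw [Real.enorm_of_nonneg hβ₀, ENNReal.ofReal_rpow_of_nonneg hβ₀ hp.le]
            apply ENNReal.ofReal_le_ofReal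
            -- Weakening `β ^ p` to `β` lets the weights `1 - β` and `β` add up to `1` in the
            -- summation over deliveries.
            calc β ^ p ≤ β ^ (1 : ℝ) := Real.rpow_le_rpow_of_exponent_ge_of_imp hβ₀ hβ₁ hp₁.le
                  (by intro _ h; linarith)
              _ = β := Real.rpow_one β
        · rw [zero_mul]

/-- The current noise, with weight `β`, acts as a potential: an accepted delivery turns `β ‖M‖ ^ p`
into `‖M'‖ ^ p`, which is at most `β ‖M‖ ^ p` plus a constant in expectation, and a rejected one
changes nothing. No moment at a random update time is needed. -/
lemma lintegral_sum_noise_le [IsProbabilityMeasure μ] [IsProbabilityMeasure D]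
    (hrun : IsFixedComputation μ ℱ D τ G K R η β x₀ c z h)
    {L p σ : ℝ} (hf : IsSmoothObjective f L) (hG : IsPBCMOracle D f G p σ)
    (hp₁ : 1 < p) (hp₂ : p ≤ 2) (hσ : 0 ≤ σ) (hβ₀ : 0 ≤ β) (hβ₁ : β ≤ 1) (s : ℕ) :
    ∫⁻ ω, (ENNReal.ofReal (1 - β) * (∑ t ∈ Finset.range s,
        if AcceptsAt G K R η β x₀ c z h t ω then
          ‖noise f G K R η β x₀ c z h (t + 1) ω‖ₑ ^ p else 0) +
      ENNReal.ofReal β * ‖noise f G K R η β x₀ c z h s ω‖ₑ ^ p) ∂μ ≤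
    ∫⁻ ω, ENNReal.ofReal (2 * (1 - β) ^ p * σ ^ p) * (∑ t ∈ Finset.range s,
        if AcceptsAt G K R η β x₀ c z h t ω then 1 else 0) ∂μ := by
  have hp : 0 < p := by linarith
  have hgrad := hf.continuous_gradient.measurable
  have hA : ∀ t, MeasurableSet {ω | AcceptsAt G K R η β x₀ c z h t ω} := fun t =>
    ℱ.le t _ (hrun.measurableSet_acceptsAt hG.measurable t)
  have hM : ∀ t, Measurable fun ω => ‖noise f G K R η β x₀ c z h t ω‖ₑ ^ p := fun t =>
    (((hrun.measurable_noise hG.measurable hgrad t).mono (ℱ.le t) le_rfl).enorm).pow_const p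
  have hone := hrun.lintegral_noise_succ_le hf hG hp₁ hp₂ hσ hβ₀ hβ₁
  set M := noise f G K R η β x₀ c z h
  set C := ENNReal.ofReal (2 * (1 - β) ^ p * σ ^ p)
  have hM0 : ∀ ω, M 0 ω = 0 := fun _ => rfl
  have hMs : ∀ t ω, ¬ AcceptsAt G K R η β x₀ c z h t ω → M (t + 1) ω = M t ω :=
    fun t ω ha => if_neg ha
  have hsum : ENNReal.ofReal (1 - β) + ENNReal.ofReal β = 1 := by
    rw [← ENNReal.ofReal_add (by linarith) hβ₀]; simp
  have hY : ∀ s, Measurable fun ω => ∑ t ∈ Finset.range s,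
      if AcceptsAt G K R η β x₀ c z h t ω then ‖M (t + 1) ω‖ₑ ^ p else 0 := fun s =>
    Finset.measurable_fun_sum _ fun t _ => Measurable.ite (hA t) (hM (t + 1)) measurable_const
  induction s with
  | zero => simp [hM0, ENNReal.zero_rpow_of_pos hp]
  | succ s ih =>
    set Y := fun ω => ∑ t ∈ Finset.range s, if AcceptsAt G K R η β x₀ c z h t ω then ‖M (t + 1) ω‖ₑ ^ p else 0 with hYdef
    have hrest : Measurable fun ω => ENNReal.ofReal (1 - β) * Y ω +
        if AcceptsAt G K R η β x₀ c z h s ω then 0 else ENNReal.ofReal β * ‖M s ω‖ₑ ^ p :=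
      ((hY s).const_mul _).add (Measurable.ite (hA s) measurable_const ((hM s).const_mul _))
    have hΦ : Measurable fun ω => ENNReal.ofReal (1 - β) * Y ω +
        ENNReal.ofReal β * ‖M s ω‖ₑ ^ p := ((hY s).const_mul _).add ((hM s).const_mul _)
    have hN : Measurable fun ω => C * ∑ t ∈ Finset.range s, if AcceptsAt G K R η β x₀ c z h t ω then (1 : ENNReal) else 0 :=
      (Finset.measurable_fun_sum _ fun t _ =>
        Measurable.ite (hA t) measurable_const measurable_const).const_mul _
    calc _ = ∫⁻ ω, ((ENNReal.ofReal (1 - β) * Y ω +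
            if AcceptsAt G K R η β x₀ c z h s ω then 0 else ENNReal.ofReal β * ‖M s ω‖ₑ ^ p) +
            if AcceptsAt G K R η β x₀ c z h s ω then ‖M (s + 1) ω‖ₑ ^ p else 0) ∂μ := by
          refine lintegral_congr fun ω => ?_
          rw [Finset.sum_range_succ, mul_add]
          by_cases ha : AcceptsAt G K R η β x₀ c z h s ω
          · simp only [if_pos ha, add_zero]
            rw [add_assoc, ← add_mul, hsum, one_mul]
          · simp only [if_neg ha, add_zero, mul_zero, hMs s ω ha, hYdef]
      _ ≤ ∫⁻ ω, (ENNReal.ofReal (1 - β) * Y ω +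
            if AcceptsAt G K R η β x₀ c z h s ω then 0 else ENNReal.ofReal β * ‖M s ω‖ₑ ^ p) ∂μ +
          ∫⁻ ω, (if AcceptsAt G K R η β x₀ c z h s ω then ENNReal.ofReal β * ‖M s ω‖ₑ ^ p + C else 0) ∂μ := by
          rw [lintegral_add_left hrest]
          exact add_le_add le_rfl (hone s)
      _ = ∫⁻ ω, (ENNReal.ofReal (1 - β) * Y ω + ENNReal.ofReal β * ‖M s ω‖ₑ ^ p) ∂μ +
          ∫⁻ ω, (C * if AcceptsAt G K R η β x₀ c z h s ω then 1 else 0) ∂μ := by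
          rw [← lintegral_add_left hrest, ← lintegral_add_left hΦ]
          refine lintegral_congr fun ω => ?_
          split_ifs
          · rw [mul_one, add_zero, add_assoc]
          · simp
      _ ≤ _ := by
          refine (add_le_add_left ih _).trans_eq ?_
          rw [← lintegral_add_left hN]
          refine lintegral_congr fun ω => ?_
          rw [Finset.sum_range_succ, mul_add]

end IsFixedComputation

/-! ### Arithmetic of the parameters. -/

section Parameters

variable {p σ ε L Δ : ℝ}

lemma paramAlpha_pos (hσ : 0 ≤ σ) (hε : 0 < ε) : 0 < paramAlpha p σ ε := by
  unfold paramAlpha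
  split_ifs with h
  · exact one_pos
  · have : 0 < σ := lt_of_le_of_ne hσ (Ne.symm h)
    exact lt_min one_pos (by positivity)

lemma paramAlpha_le_one : paramAlpha p σ ε ≤ 1 := by
  unfold paramAlpha
  split_ifs
  · exact le_rfl
  · exact min_le_left _ _

/-- The step sizes are small enough for the noise level. -/
lemma paramAlpha_noise (hp₁ : 1 < p) (hσ : 0 ≤ σ) (hε : 0 < ε) :
    2 * paramAlpha p σ ε ^ p * σ ^ p ≤ paramAlpha p σ ε * (ε / 6) ^ p := by
  have hα := paramAlpha_pos (p := p) hσ hε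
  have hp : 0 < p := by linarith
  rcases hσ.eq_or_lt with rfl | hσ'
  · rw [Real.zero_rpow hp.ne', mul_zero]; positivity
  have h1 : paramAlpha p σ ε ≤ (ε / (3 * 2 ^ ((p + 1) / p) * σ)) ^ (p / (p - 1)) := by
    unfold paramAlpha
    rw [if_neg hσ'.ne']
    exact min_le_right _ _
  have h2 : paramAlpha p σ ε ^ (p - 1) ≤ (ε / (3 * 2 ^ ((p + 1) / p) * σ)) ^ p := by
    have := Real.rpow_le_rpow hα.le h1 (show 0 ≤ p - 1 by linarith)
    rwa [← Real.rpow_mul (by positivity), div_mul_cancel₀ _ (by linarith)] at this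
  -- This explains the constant in `α`: the `2` cancels the von Bahr–Esseen factor and the `6`
  -- produces the noise level `ε / 6`.
  have h3 : ((3 : ℝ) * 2 ^ ((p + 1) / p)) ^ p = 2 * 6 ^ p := by
    rw [Real.mul_rpow (by norm_num) (by positivity), ← Real.rpow_mul (by norm_num),
      div_mul_cancel₀ _ hp.ne', Real.rpow_add_one (by norm_num),
      show (6 : ℝ) = 3 * 2 by norm_num, Real.mul_rpow (by norm_num) (by norm_num)]
    ring
  rw [Real.div_rpow hε.le (by positivity), Real.mul_rpow (by positivity) hσ, h3] at h2
  have h4 : paramAlpha p σ ε ^ p = paramAlpha p σ ε * paramAlpha p σ ε ^ (p - 1) := by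
    rw [← Real.rpow_one_add' hα.le (by linarith)]; congr 1; ring
  rw [h4, Real.div_rpow hε.le (by norm_num)]
  have h5 : 0 < σ ^ p := by positivity
  have h6 : (0 : ℝ) < 6 ^ p := by positivity
  calc _ = 2 * paramAlpha p σ ε * σ ^ p * paramAlpha p σ ε ^ (p - 1) := by ring
    _ ≤ 2 * paramAlpha p σ ε * σ ^ p * (ε ^ p / (2 * 6 ^ p * σ ^ p)) := by gcongr
    _ = _ := by field_simp

lemma one_div_paramAlpha_le (hσ : 0 ≤ σ) (hε : 0 < ε) :
    1 / paramAlpha p σ ε ≤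
      1 + (3 * 2 ^ ((p + 1) / p)) ^ (p / (p - 1)) * (σ ^ (p / (p - 1)) / ε ^ (p / (p - 1))) := by
  have hnn : 0 ≤
      (3 * 2 ^ ((p + 1) / p)) ^ (p / (p - 1)) * (σ ^ (p / (p - 1)) / ε ^ (p / (p - 1))) := by
    positivity
  unfold paramAlpha
  split_ifs with h
  · linarith
  · rcases min_choice 1 ((ε / (3 * 2 ^ ((p + 1) / p) * σ)) ^ (p / (p - 1))) with h1 | h1 <;> rw [h1]
    · linarith
    · rw [Real.div_rpow hε.le (by positivity), Real.mul_rpow (by positivity) hσ, one_div_div,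
        mul_div_assoc]
      linarith

lemma paramR_pos (hσ : 0 ≤ σ) (hε : 0 < ε) : 0 < paramR p σ ε := by
  have := paramAlpha_pos (p := p) hσ hε
  exact Nat.ceil_pos.mpr (by positivity)

lemma paramR_lt (hσ : 0 ≤ σ) (hε : 0 < ε) : (paramR p σ ε : ℝ) < 1 / paramAlpha p σ ε + 1 := by
  have := paramAlpha_pos (p := p) hσ hε
  exact Nat.ceil_lt_add_one (by positivity)

lemma paramK_pos (hσ : 0 ≤ σ) (hε : 0 < ε) (hL : 0 < L) (hΔ : 0 < Δ) :
    0 < paramK p σ ε L Δ := by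
  have := paramAlpha_pos (p := p) hσ hε
  exact Nat.ceil_pos.mpr (by positivity)

lemma paramK_lt (hσ : 0 ≤ σ) (hε : 0 < ε) (hL : 0 < L) (hΔ : 0 < Δ) :
    (paramK p σ ε L Δ : ℝ) < 72 * L * Δ / (paramAlpha p σ ε * ε ^ 2) + 1 := by
  have := paramAlpha_pos (p := p) hσ hε
  exact Nat.ceil_lt_add_one (by positivity)

/-- Comparison of `⌈K / R⌉` epochs of `R` updates with one term of the time complexity. -/
lemma epochs_mul_time_le (hp₁ : 1 < p) (hσ : 0 ≤ σ) (hε : 0 < ε) (hL : 0 < L)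
    (hΔ : 0 < Δ) (hsmall : ε ≤ √(2 * L * Δ)) {m a : ℕ} (hm : 1 ≤ m) (ha : a ≤ m)
    {H : ℝ} (hH : 0 < H) :
    (((paramK p σ ε L Δ : ℝ) - 1) / paramR p σ ε + 1) * ((paramR p σ ε + 2 * a) / H) ≤
      74 * (4 + (3 * 2 ^ ((p + 1) / p)) ^ (p / (p - 1))) * ((1 / (m : ℝ) * H)⁻¹ *
        (L * Δ / ε ^ 2 +
          L * σ ^ (p / (p - 1)) * Δ / ((m : ℝ) * ε ^ ((3 * p - 2) / (p - 1))))) := by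
  have hα := paramAlpha_pos (p := p) hσ hε
  have hRinv := Nat.le_ceil (1 / paramAlpha p σ ε)
  have hRpos : (0 : ℝ) < paramR p σ ε := by exact_mod_cast paramR_pos hσ hε
  have hRlt := paramR_lt (p := p) hσ hε
  have hαinv := one_div_paramAlpha_le (p := p) hσ hε
  have hK := paramK_lt (p := p) hσ hε hL hΔ
  set α := paramAlpha p σ ε
  set B : ℝ := (3 * 2 ^ ((p + 1) / p)) ^ (p / (p - 1)) with hB
  have hB0 : 0 ≤ B := by positivity
  set X := L * Δ / ε ^ 2 with hX
  have hXhalf : 1 / 2 ≤ X := by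
    have := (Real.le_sqrt' hε).mp hsmall
    rw [hX, le_div_iff₀ (by positivity)]
    linarith
  have hm' : (1 : ℝ) ≤ m := by exact_mod_cast hm
  have hexp : ε ^ ((3 * p - 2) / (p - 1)) = ε ^ 2 * ε ^ (p / (p - 1)) := by
    have hp' : p - 1 ≠ 0 := by linarith
    rw [← Real.rpow_natCast ε 2, ← Real.rpow_add hε]
    congr 1
    push_cast
    field_simp
    ring
  set s := σ ^ (p / (p - 1)) / ε ^ (p / (p - 1)) with hs
  have hs0 : 0 ≤ s := by positivity
  have hterm : L * σ ^ (p / (p - 1)) * Δ / ((m : ℝ) * ε ^ ((3 * p - 2) / (p - 1))) = X * s / m := by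
    rw [hexp, hX, hs]
    have := Real.rpow_pos_of_pos hε (p / (p - 1))
    field_simp
  -- As `R ≥ 1 / α`, the factor `1 / α` in `K` cancels. The extra epoch is absorbed by `1 ≤ 2 * X`,
  -- where `ε ≤ √(2LΔ)` enters.
  have hfirst : ((paramK p σ ε L Δ : ℝ) - 1) / paramR p σ ε + 1 ≤ 74 * X := by
    have h1 : ((paramK p σ ε L Δ : ℝ) - 1) / paramR p σ ε ≤ 72 * X := by
      rw [div_le_iff₀ hRpos]
      calc (paramK p σ ε L Δ : ℝ) - 1 ≤ 72 * L * Δ / (α * ε ^ 2) := by linarith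
        _ = 72 * X * (1 / α) := by rw [hX]; field_simp
        _ ≤ 72 * X * paramR p σ ε := by gcongr; exact hRinv
    linarith
  -- `R < 1 / α + 1 ≤ 2 + B * s`, and `2 + 2 * a ≤ 4 * m`.
  have hsecond : (paramR p σ ε + 2 * a : ℝ) ≤ 4 * m + B * s := by
    have : (a : ℝ) ≤ m := by exact_mod_cast ha
    linarith
  rw [hterm]
  calc _ ≤ 74 * X * ((4 * m + B * s) / H) := by gcongr
    _ = 74 * ((1 / (m : ℝ) * H)⁻¹ * (4 * X + B * (X * s / m))) := by field_simp
    _ ≤ 74 * ((1 / (m : ℝ) * H)⁻¹ * ((4 + B) * (X + X * s / m))) := by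
        have : 0 ≤ X * s / m := by positivity
        gcongr
        nlinarith
    _ = _ := by ring

end Parameters

/-! ### Expected gradient norm at the random output. -/

/-- Evaluating a process at a uniform index which is independent of it. -/
lemma IsUniformIndex.integral_eq {Ω : Type*} {mΩ : MeasurableSpace Ω} {μ : Measure Ω}
    [IsProbabilityMeasure μ] {ℱ : Filtration ℕ mΩ} {K : ℕ} {J : Ω → ℕ}
    (hJ : IsUniformIndex μ ℱ K J) {F : ℕ → Ω → ℝ}
    (hF : ∀ j, Measurable[⨆ s, ℱ s] (F j)) {B : ℝ} (hB : ∀ j ω, ‖F j ω‖ ≤ B) :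
    Integrable (fun ω => F (J ω) ω) μ ∧
      ∫ ω, F (J ω) ω ∂μ = (K : ℝ)⁻¹ * ∫ ω, ∑ j ∈ Finset.range K, F j ω ∂μ := by
  have hF' : ∀ j, Measurable (F j) := fun j => (hF j).mono (iSup_le ℱ.le) le_rfl
  have hint : ∀ j, Integrable (F j) μ := fun j =>
    Integrable.of_bound (hF' j).aestronglyMeasurable B (Filter.Eventually.of_forall (hB j))
  have hcount : Measure.count (Set.Iio K) = (K : ENNReal) := by
    rw [← Finset.coe_Iio, Measure.count_apply_finset]; simp
  have hlt : ∀ᵐ ω ∂μ, J ω < K := by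
    have h1 : μ.map J (Set.Iio K)ᶜ = 0 := by
      rw [hJ.law, uniformOn, cond_apply measurableSet_Iio, Set.inter_compl_self, measure_empty, mul_zero]
    rw [Measure.map_apply hJ.measurable measurableSet_Iio.compl] at h1
    rw [ae_iff]
    exact h1
  have hprob : ∀ j < K, μ.real (J ⁻¹' {j}) = (K : ℝ)⁻¹ := by
    intro j hj
    have h1 : μ.map J {j} = (K : ENNReal)⁻¹ := by
      rw [hJ.law, uniformOn, cond_apply measurableSet_Iio, hcount,
        Set.inter_eq_right.mpr (by simpa using hj), Measure.count_singleton, mul_one]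
    rw [Measure.map_apply hJ.measurable (measurableSet_singleton j)] at h1
    simp [Measure.real, h1]
  refine ⟨Integrable.of_bound
    (Measurable.apply_countable hF' hJ.measurable).aestronglyMeasurable B
    (Filter.Eventually.of_forall fun ω => hB _ ω), ?_⟩
  have hset : ∀ j, MeasurableSet (J ⁻¹' {j}) := fun j => hJ.measurable (measurableSet_singleton j)
  have hmul : ∀ j < K, ∫ ω, (J ⁻¹' {j}).indicator (fun _ => (1 : ℝ)) ω * F j ω ∂μ =
      (K : ℝ)⁻¹ * ∫ ω, F j ω ∂μ := by
    intro j hj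
    have hind : IndepFun ((J ⁻¹' {j}).indicator fun _ => (1 : ℝ)) (F j) μ := by
      rw [IndepFun_iff_Indep]
      refine indep_of_indep_of_le_left (indep_of_indep_of_le_right hJ.indep (hF j).comap_le) ?_
      refine Measurable.comap_le ?_
      exact Measurable.indicator (m := MeasurableSpace.comap J inferInstance) measurable_const
        ⟨{j}, measurableSet_singleton j, rfl⟩
    rw [hind.integral_fun_mul_eq_mul_integral
      (measurable_const.indicator (hset j)).aestronglyMeasurable (hF' j).aestronglyMeasurable,
      integral_indicator_const _ (hset j), hprob j hj, smul_eq_mul, mul_one]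
  calc ∫ ω, F (J ω) ω ∂μ
      = ∫ ω, ∑ j ∈ Finset.range K, (J ⁻¹' {j}).indicator (fun _ => (1 : ℝ)) ω * F j ω ∂μ := by
        refine integral_congr_ae ?_
        filter_upwards [hlt] with ω hω
        rw [Finset.sum_eq_single (J ω)]
        · simp
        · intro j _ hj
          simp [Set.indicator, hj.symm]
        · intro hcon
          exact absurd (Finset.mem_range.mpr hω) hcon
    _ = ∑ j ∈ Finset.range K, (K : ℝ)⁻¹ * ∫ ω, F j ω ∂μ := by
        rw [integral_finsetSum _ fun j _ => (hint j).bdd_mul (c := 1)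
          (measurable_const.indicator (hset j)).aestronglyMeasurable
          (Filter.Eventually.of_forall fun ω => by
            by_cases h : J ω = j <;> simp [Set.indicator, h])]
        exact Finset.sum_congr rfl fun j hj => hmul j (Finset.mem_range.mp hj)
    _ = _ := by rw [integral_finsetSum _ fun j _ => hint j, Finset.mul_sum]

namespace IsFixedComputation

open RState

variable {n d : ℕ} {Ω Ξ : Type*} {mΩ : MeasurableSpace Ω} [MeasurableSpace Ξ]
    {μ : Measure Ω} {ℱ : Filtration ℕ mΩ} {D : Measure Ξ} {τ : Fin n → ℝ}
    {G : EuclideanSpace ℝ (Fin d) → Ξ → EuclideanSpace ℝ (Fin d)}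
    {K R : ℕ} {η β : ℝ} {x₀ : EuclideanSpace ℝ (Fin d)}
    {c : ℕ → Ω → Fin n} {z : ℕ → Ω → Ξ} {h : ℕ → Fin n → Ω → ℝ}
    {f : EuclideanSpace ℝ (Fin d) → ℝ}

/-- Total `p`-th moment of the noise in the momentum vectors used by the `K` updates. -/
lemma integral_sum_noise_le [IsProbabilityMeasure μ] [IsProbabilityMeasure D]
    (hrun : IsFixedComputation μ ℱ D τ G K R η β x₀ c z h)
    {L p σ l : ℝ} (hf : IsSmoothObjective f L) (hG : IsPBCMOracle D f G p σ)
    (hp₁ : 1 < p) (hp₂ : p ≤ 2) (hσ : 0 ≤ σ) (hβ₀ : 0 ≤ β) (hβ₁ : β < 1) (hl : 0 ≤ l)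
    (hnoise : 2 * (1 - β) ^ p * σ ^ p ≤ (1 - β) * l ^ p) (s : ℕ) :
    Integrable (fun ω => ∑ t ∈ Finset.range s, if AcceptsAt G K R η β x₀ c z h t ω then
        ‖noise f G K R η β x₀ c z h (t + 1) ω‖ ^ p else 0) μ ∧
      ∫ ω, (∑ t ∈ Finset.range s, if AcceptsAt G K R η β x₀ c z h t ω then
        ‖noise f G K R η β x₀ c z h (t + 1) ω‖ ^ p else 0) ∂μ ≤ K * l ^ p := by
  have hp : 0 ≤ p := by linarith
  set Y : Ω → ℝ := fun ω => ∑ t ∈ Finset.range s, if AcceptsAt G K R η β x₀ c z h t ω then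
        ‖noise f G K R η β x₀ c z h (t + 1) ω‖ ^ p else 0 with hYdef
  have hnn : ∀ ω t, 0 ≤ if AcceptsAt G K R η β x₀ c z h t ω then
      ‖noise f G K R η β x₀ c z h (t + 1) ω‖ ^ p else 0 := fun ω t => by
    split_ifs <;> positivity
  have hY0 : ∀ ω, 0 ≤ Y ω := fun ω => Finset.sum_nonneg fun t _ => hnn ω t
  have hYm : Measurable Y := Finset.measurable_fun_sum _ fun t _ => Measurable.ite
    (ℱ.le t _ (hrun.measurableSet_acceptsAt hG.measurable t))
    (((hrun.measurable_noise hG.measurable hf.continuous_gradient.measurable (t + 1)).mono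
      (ℱ.le (t + 1)) le_rfl).norm.pow_const p) measurable_const
  have hYof : ∀ ω, ENNReal.ofReal (Y ω) =
      ∑ t ∈ Finset.range s, if AcceptsAt G K R η β x₀ c z h t ω then
        ‖noise f G K R η β x₀ c z h (t + 1) ω‖ₑ ^ p else 0 := fun ω => by
    rw [hYdef, ENNReal.ofReal_sum_of_nonneg fun t _ => hnn ω t]
    refine Finset.sum_congr rfl fun t _ => ?_
    split_ifs
    · rw [← ofReal_norm, ENNReal.ofReal_rpow_of_nonneg (norm_nonneg _) hp]
    · simp
  have hβ' : 0 < 1 - β := by linarith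
  have hcnt : ∀ ω, (∑ t ∈ Finset.range s,
      if AcceptsAt G K R η β x₀ c z h t ω then (1 : ENNReal) else 0) ≤ K := fun ω => by
    have hS := isTrace_run G x₀ (fun t => c t ω) (fun t => z t ω) (fun t j => h t j ω) K R η β
    have h1 := hS.sum_accepts rfl s
    have h2 := hS.k_le rfl s
    rw [← Nat.cast_le (α := ℝ), ← h1, Finset.sum_boole, Nat.cast_le] at h2
    rw [Finset.sum_boole]
    exact_mod_cast h2
  have hlin : ∫⁻ ω, ENNReal.ofReal (Y ω) ∂μ ≤ ENNReal.ofReal (K * l ^ p) := by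
    have h1 := hrun.lintegral_sum_noise_le hf hG hp₁ hp₂ hσ hβ₀ hβ₁.le s
    have h2 : ENNReal.ofReal (1 - β) * ∫⁻ ω, ENNReal.ofReal (Y ω) ∂μ ≤
        ENNReal.ofReal (1 - β) * ENNReal.ofReal (K * l ^ p) := by
      rw [← lintegral_const_mul _ hYm.ennreal_ofReal]
      calc _ ≤ _ := lintegral_mono fun ω => by
            rw [hYof ω]
            exact le_self_add
        _ ≤ _ := h1
        _ ≤ ∫⁻ _, ENNReal.ofReal (2 * (1 - β) ^ p * σ ^ p) * K ∂μ :=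
            lintegral_mono fun ω => mul_le_mul_right (hcnt ω) _
        _ = ENNReal.ofReal (2 * (1 - β) ^ p * σ ^ p * K) := by
            rw [lintegral_const, measure_univ, mul_one, ENNReal.ofReal_mul' (Nat.cast_nonneg K),
              ENNReal.ofReal_natCast]
        _ ≤ ENNReal.ofReal ((1 - β) * (K * l ^ p)) := by
            apply ENNReal.ofReal_le_ofReal
            have : (2 * (1 - β) ^ p * σ ^ p) * K ≤ ((1 - β) * l ^ p) * K := by gcongr
            linarith
        _ = _ := ENNReal.ofReal_mul hβ'.le
    exact (ENNReal.mul_le_mul_iff_right (by simpa using hβ₁) ENNReal.ofReal_ne_top).mp h2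
  have hYi : Integrable Y μ := ⟨hYm.aestronglyMeasurable, by
    rw [hasFiniteIntegral_iff_ofReal (Filter.Eventually.of_forall hY0)]
    exact hlin.trans_lt ENNReal.ofReal_lt_top⟩
  refine ⟨hYi, ?_⟩
  rw [← ENNReal.ofReal_le_ofReal_iff (by positivity), ofReal_integral_eq_lintegral_ofReal hYi
    (Filter.Eventually.of_forall hY0)]
  exact hlin

/-- Mean gradient norm along the run, for arbitrary admissible parameters. -/
lemma integral_sum_norm_gradient_le [IsProbabilityMeasure μ] [IsProbabilityMeasure D]
    (hrun : IsFixedComputation μ ℱ D τ G K R η β x₀ c z h)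
    {L p σ l Q : ℝ} (hf : IsSmoothObjective f L) (hG : IsPBCMOracle D f G p σ) (hL : 0 ≤ L)
    (hp₁ : 1 < p) (hp₂ : p ≤ 2) (hσ : 0 ≤ σ) (hη : 0 < η) (hR : 0 < R)
    (hβ₀ : 0 ≤ β) (hβ₁ : β < 1) (hl : 0 < l)
    (hnoise : 2 * (1 - β) ^ p * σ ^ p ≤ (1 - β) * l ^ p) (hQ₀ : 0 ≤ Q)
    (hQ : β * (L * η) + (1 - β) * ((R - 1) * (L * η)) ≤ (1 - β) * Q)
    {s : ℕ} (hs : ∀ ω, (run G K R η β x₀ (fun t => c t ω) (fun t => z t ω)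
      (fun t j => h t j ω) s).k = K) :
    ∫ ω, ∑ j ∈ Finset.range K, ‖gradient f ((run G K R η β x₀ (fun t => c t ω) (fun t => z t ω)
        (fun t j => h t j ω) s).iter j)‖ ∂μ ≤
      initialGap f x₀ / η + 2 * (K * l + K * Q + ‖gradient f x₀‖ / (1 - β)) +
        K * (L / 2 * η) := by
  obtain ⟨hYi, hY⟩ := hrun.integral_sum_noise_le hf hG hp₁ hp₂ hσ hβ₀ hβ₁ hl.le hnoise s
  set Y : Ω → ℝ := fun ω => ∑ t ∈ Finset.range s, if AcceptsAt G K R η β x₀ c z h t ω then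
        ‖noise f G K R η β x₀ c z h (t + 1) ω‖ ^ p else 0 with hYdef
  have hβ' : 0 < 1 - β := by linarith
  have hp : 0 < p := by linarith
  -- Young's inequality at level `l` is linear in the `p`-th power, so it can be summed over a
  -- random set of deliveries. Its shares `l / p` and `(1 - 1 / p) * l` recombine to `l` after
  -- taking expectations.
  set b := 1 / (p * l ^ (p - 1)) with hb
  set A := initialGap f x₀ / η +
    2 * (K * ((1 - 1 / p) * l) + K * Q + ‖gradient f x₀‖ / (1 - β)) + K * (L / 2 * η) with hA
  have hpath : ∀ ω, ∑ j ∈ Finset.range K, ‖gradient f ((run G K R η β x₀ (fun t => c t ω)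
      (fun t => z t ω) (fun t j => h t j ω) s).iter j)‖ ≤ A + 2 * b * Y ω := by
    intro ω
    have hS := isTrace_run G x₀ (fun t => c t ω) (fun t => z t ω) (fun t j => h t j ω) K R η β
    have hmain := hS.sum_norm_gradient_le hf hL hη.le hβ₀ hβ₁ hR rfl (fun _ => rfl)
      (fun _ => rfl) hQ₀ hQ s
    have hcount := hS.sum_accepts rfl s
    rw [hs ω] at hmain hcount
    set S := run G K R η β x₀ (fun t => c t ω) (fun t => z t ω) (fun t j => h t j ω)
    set M := noisePart K R β S (fun t => c t ω)
      (fun t => G ((S t).point (c t ω)) (z t ω) - gradient f ((S t).point (c t ω)))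
    have hx0 : (S 0).iter 0 = x₀ := rfl
    rw [hx0] at hmain
    have hV : (∑ t ∈ Finset.range s, if Accepts K R (S t) (c t ω) then ‖M (t + 1)‖ else 0) ≤
        b * Y ω + K * ((1 - 1 / p) * l) := by
      rw [← hcount, hYdef, Finset.mul_sum, Finset.sum_mul, ← Finset.sum_add_distrib]
      refine Finset.sum_le_sum fun t _ => ?_
      by_cases ha : Accepts K R (S t) (c t ω)
      · have ha' : AcceptsAt G K R η β x₀ c z h t ω := ha
        rw [if_pos ha, if_pos ha, if_pos ha', one_mul]
        exact le_rpow_div_add hp₁ (norm_nonneg _) hl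
      · have ha' : ¬ AcceptsAt G K R η β x₀ c z h t ω := ha
        rw [if_neg ha, if_neg ha, if_neg ha', mul_zero, zero_mul, add_zero]
    have hgeo : ∑ j ∈ Finset.range K, β ^ j ≤ 1 / (1 - β) := by
      rw [le_div_iff₀ hβ', geom_sum_mul_neg]
      linarith [pow_nonneg hβ₀ K]
    have hgap := hf.sub_le_initialGap x₀ ((S s).iter K)
    have hgeo' : (∑ j ∈ Finset.range K, β ^ j) * ‖gradient f x₀‖ ≤
        ‖gradient f x₀‖ / (1 - β) := by
      rw [div_eq_inv_mul, ← one_div]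
      gcongr
    refine le_of_mul_le_mul_left ?_ hη
    refine hmain.trans ?_
    have hin : 2 * η * ((∑ t ∈ Finset.range s,
          if Accepts K R (S t) (c t ω) then ‖M (t + 1)‖ else 0) +
        K * Q + (∑ j ∈ Finset.range K, β ^ j) * ‖gradient f x₀‖) ≤
        2 * η * ((b * Y ω + K * ((1 - 1 / p) * l)) + K * Q + ‖gradient f x₀‖ / (1 - β)) := by
      gcongr
    have hη' : η * (initialGap f x₀ / η) = initialGap f x₀ := by field_simp
    have : η * (A + 2 * b * Y ω) = initialGap f x₀ +
        2 * η * ((b * Y ω + K * ((1 - 1 / p) * l)) + K * Q + ‖gradient f x₀‖ / (1 - β)) +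
        K * (L / 2 * η ^ 2) := by
      rw [hA]
      linear_combination hη'
    rw [this]
    linarith
  have hbl : b * l ^ p = l / p := by
    have : l ^ p = l ^ (p - 1) * l := by rw [← Real.rpow_add_one hl.ne']; congr 1; ring
    rw [hb, this]
    have := Real.rpow_pos_of_pos hl (p - 1)
    field_simp
  calc _ ≤ ∫ ω, (A + 2 * b * Y ω) ∂μ := by
        refine integral_mono_of_nonneg (Filter.Eventually.of_forall fun ω => by positivity)
          ((integrable_const A).add (hYi.const_mul _)) (Filter.Eventually.of_forall hpath)
    _ = A + 2 * b * ∫ ω, Y ω ∂μ := by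
        rw [integral_add (integrable_const A) (hYi.const_mul _), integral_const_mul]; simp
    _ ≤ A + 2 * b * (K * l ^ p) := by gcongr
    _ = _ := by
        rw [hA]
        linear_combination (2 * K : ℝ) * hbl

end IsFixedComputation

/-- Numerical core of the convergence bound when the initial gap is not too small: here `g₀` bounds
the initial gradient norm and `A = α`. -/
lemma mean_bound_of_large_gap {L Δ ε A K g₀ η : ℝ} (hL : 0 < L) (hΔ : 0 < Δ) (hε : 0 < ε)
    (hA : 0 < A) (hA₁ : A ≤ 1) (hK : 72 * L * Δ / (A * ε ^ 2) ≤ K) (hg : g₀ ≤ √(2 * L * Δ))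
    (hlarge : ε / 2 ≤ √(2 * L * Δ)) (hη : η = A * ε / (24 * L)) :
    Δ / η + 2 * (K * (ε / 6) + K * (ε / 12) + g₀ / A) + K * (L / 2 * η) ≤ K * ε := by
  have hK0 : 0 ≤ K := le_trans (by positivity) hK
  set r := √(2 * L * Δ)
  have hr : r ^ 2 = 2 * L * Δ := Real.sq_sqrt (by positivity)
  have h1 : Δ / η ≤ K * ε / 3 := by
    have h2 : Δ / η = 72 * L * Δ / (A * ε ^ 2) * ε / 3 := by rw [hη]; field_simp; ring
    rw [h2]
    gcongr
  -- The only use of `hlarge`: it gives `r ≤ 2 * r ^ 2 / ε`, which is proportional to `L * Δ / ε`.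
  have h3 : g₀ / A ≤ K * ε / 18 := by
    calc g₀ / A ≤ r / A := by gcongr
      _ ≤ 2 * r ^ 2 / (A * ε) := by
        rw [div_le_div_iff₀ hA (by positivity)]
        have h4 : 0 ≤ r * A * (2 * r - ε) :=
          mul_nonneg (mul_nonneg (Real.sqrt_nonneg _) hA.le) (by linarith)
        linarith
      _ = 72 * L * Δ / (A * ε ^ 2) * ε / 18 := by rw [hr]; field_simp; ring
      _ ≤ K * ε / 18 := by gcongr
  have h5 : K * (L / 2 * η) ≤ K * ε / 48 := by
    have h6 : K * (L / 2 * η) = A * (K * ε / 48) := by rw [hη]; field_simp; ring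
    rw [h6]
    exact mul_le_of_le_one_left (by positivity) hA₁
  -- The shares of `K * ε` are `1/3`, `2 * (1/6 + 1/12 + 1/18)` and `1/48`, with sum below `1`.
  have : 0 ≤ K * ε := by positivity
  linarith

/-- If the initial gap is small then all points within reach are stationary. -/
lemma gradient_bound_of_small_gap {L Δ ε A K g₀ η j : ℝ} (hL : 0 < L) (hΔ : 0 < Δ) (hε : 0 < ε)
    (hA : 0 < A) (hK : K < 72 * L * Δ / (A * ε ^ 2) + 1) (hg : g₀ ≤ √(2 * L * Δ))
    (hsmall : √(2 * L * Δ) ≤ ε / 2) (hη : η = A * ε / (24 * L)) (hj : j + 1 ≤ K) :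
    g₀ + j * (L * η) ≤ ε := by
  have hr : √(2 * L * Δ) ^ 2 = 2 * L * Δ := Real.sq_sqrt (by positivity)
  -- With `j ≤ K - 1` the ceiling in `K` does no harm, even when `K = 1`.
  have h1 : j * (L * η) ≤ 3 / 8 * ε := by
    have h2 : L * η = A * ε / 24 := by rw [hη]; field_simp
    rw [h2]
    calc j * (A * ε / 24) ≤ 72 * L * Δ / (A * ε ^ 2) * (A * ε / 24) := by
          gcongr
          linarith
      _ = 3 / 2 * (2 * L * Δ) / ε := by field_simp; ring
      _ ≤ 3 / 2 * (ε / 2) ^ 2 / ε := by rw [← hr]; gcongr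
      _ = 3 / 8 * ε := by field_simp; ring
  linarith

/-! ### Assembly for the prescribed parameters. -/

namespace IsFixedComputation

open RState

variable {n d : ℕ} {Ω Ξ : Type*} {mΩ : MeasurableSpace Ω} [MeasurableSpace Ξ]
    {μ : Measure Ω} {ℱ : Filtration ℕ mΩ} {D : Measure Ξ} {τ : Fin n → ℝ}
    {G : EuclideanSpace ℝ (Fin d) → Ξ → EuclideanSpace ℝ (Fin d)}
    {x₀ : EuclideanSpace ℝ (Fin d)}
    {c : ℕ → Ω → Fin n} {z : ℕ → Ω → Ξ} {h : ℕ → Fin n → Ω → ℝ}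
    {f : EuclideanSpace ℝ (Fin d) → ℝ}

lemma isEpsStationary [IsProbabilityMeasure μ] [IsProbabilityMeasure D] {p σ ε L Δ : ℝ}
    (hp₁ : 1 < p) (hp₂ : p ≤ 2) (hL : 0 < L) (hσ : 0 ≤ σ) (hε : 0 < ε)
    (hf : IsSmoothObjective f L) (hΔ : Δ = initialGap f x₀) (hΔpos : 0 < Δ)
    (hG : IsPBCMOracle D f G p σ)
    (hrun : IsFixedComputation μ ℱ D τ G (paramK p σ ε L Δ) (paramR p σ ε) (paramEta p σ ε L)
      (paramBeta p σ ε) x₀ c z h)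
    {J : Ω → ℕ} (hJ : IsUniformIndex μ ℱ (paramK p σ ε L Δ) J) :
    IsEpsStationary μ f ε fun ω => (final G (paramK p σ ε L Δ) (paramR p σ ε) (paramEta p σ ε L)
      (paramBeta p σ ε) x₀ (fun s => c s ω) (fun s => z s ω) (fun s i => h s i ω)).iter (J ω) := by
  have hα := paramAlpha_pos (p := p) hσ hε
  have hα₁ := paramAlpha_le_one (p := p) (σ := σ) (ε := ε)
  have hRpos := paramR_pos (p := p) hσ hε
  have hRlt := paramR_lt (p := p) hσ hε
  have hKpos := paramK_pos (p := p) hσ hε hL hΔpos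
  have hKlt := paramK_lt (p := p) hσ hε hL hΔpos
  have hKge : 72 * L * Δ / (paramAlpha p σ ε * ε ^ 2) ≤ paramK p σ ε L Δ := Nat.le_ceil _
  have hnoise := paramAlpha_noise hp₁ hσ hε
  have hg := hf.norm_gradient_le hL x₀
  rw [← hΔ] at hg
  have hη : paramEta p σ ε L = paramAlpha p σ ε * ε / (24 * L) := rfl
  have hβ : paramBeta p σ ε = 1 - paramAlpha p σ ε := rfl
  set α := paramAlpha p σ ε
  set K := paramK p σ ε L Δ
  set R := paramR p σ ε
  set η := paramEta p σ ε L
  set β := paramBeta p σ ε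
  have hηpos : 0 < η := by rw [hη]; positivity
  have hβ' : 1 - β = α := by rw [hβ]; ring
  have hLη : L * η = α * ε / 24 := by rw [hη]; field_simp
  have hLη0 : 0 ≤ L * η := by positivity
  simp only [fun ω => final_eq_run (K := K) (η := η) (β := β) G x₀ (fun s => c s ω)
    (fun s => z s ω) (fun s i => h s i ω) hRpos]
  set T : Ω → RState n d := fun ω => run G K R η β x₀ (fun s => c s ω) (fun s => z s ω)
    (fun s i => h s i ω) (K * (n + 1)) with hT
  have htr : ∀ ω, IsTrace K R η β _ _ _ _ := fun ω => isTrace_run G x₀ (fun s => c s ω)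
    (fun s => z s ω) (fun s i => h s i ω) K R η β
  have hTk : ∀ ω, (T ω).k = K := fun ω => (htr ω).k_eq_of_le hRpos rfl
  have hle : ∀ ω j, j ≤ K → ‖gradient f ((T ω).iter j)‖ ≤ ‖gradient f x₀‖ + j * (L * η) := by
    intro ω j hj
    have h1 := (htr ω).norm_gradient_sub_le hf hL.le hηpos.le rfl (K * (n + 1)) (Nat.zero_le j)
      (hj.trans_eq (hTk ω).symm) (m := j) (by omega)
    rw [(htr ω).iter_zero, norm_sub_rev] at h1
    have h2 := norm_le_norm_add_norm_sub' (gradient f ((T ω).iter j)) (gradient f x₀)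
    exact h2.trans (add_le_add le_rfl h1)
  have hbound : ∀ j ω, ‖‖gradient f ((T ω).iter j)‖‖ ≤ ‖gradient f x₀‖ + K * (L * η) := by
    intro j ω
    rw [norm_norm]
    rcases le_or_gt j K with hj | hj
    · refine (hle ω j hj).trans ?_
      have : (j : ℝ) * (L * η) ≤ K * (L * η) :=
        mul_le_mul_of_nonneg_right (by exact_mod_cast hj) hLη0
      linarith
    · have h1 : (T ω).iter j = x₀ :=
        (htr ω).iter_of_lt _ ((hTk ω).trans_lt hj)
      rw [h1]
      have : 0 ≤ (K : ℝ) * (L * η) := by positivity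
      linarith
  have hmeas := hrun.measurable_run hG.measurable (K * (n + 1))
  have hFm : ∀ j, Measurable[⨆ s, ℱ s] fun ω => ‖gradient f ((T ω).iter j)‖ := by
    intro j
    have h1 := (@MeasurableState.iter n d Ω (ℱ (K * (n + 1))) T hmeas j).mono
      (le_iSup (fun s => ℱ s) (K * (n + 1))) le_rfl
    exact (hf.continuous_gradient.norm.measurable).comp h1
  obtain ⟨hint, heq⟩ := hJ.integral_eq hFm hbound
  refine ⟨hint, ?_⟩
  have hK0 : (0 : ℝ) < K := by exact_mod_cast hKpos
  rw [heq, inv_mul_le_iff₀ hK0]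
  rcases le_or_gt (ε / 2) (√(2 * L * Δ)) with hlarge | hsmall
  -- Drift and staleness contribute at most `L * η = α * ε / 24` each, the latter because `R - 1 < 1
  -- / α`.
  · have hQ : β * (L * η) + (1 - β) * ((R - 1) * (L * η)) ≤ (1 - β) * (ε / 12) := by
      have h1 : α * ((R - 1) * (L * η)) ≤ α * (1 / α * (L * η)) := by
        gcongr
        linarith
      have h2 : α * (1 / α * (L * η)) = L * η := by field_simp
      rw [hβ', hβ]
      nlinarith
    have h1 := hrun.integral_sum_norm_gradient_le (l := ε / 6) (Q := ε / 12)
      (s := K * (n + 1)) hf hG hL.le hp₁ hp₂ hσ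
      hηpos hRpos (by linarith) (by linarith) (by positivity) (by rw [hβ']; exact hnoise)
      (by positivity) hQ hTk
    rw [hβ', ← hΔ] at h1
    exact h1.trans (mean_bound_of_large_gap hL hΔpos hε hα hα₁ hKge hg hlarge hη)
  · have h1 : ∀ ω, ∑ j ∈ Finset.range K, ‖gradient f ((T ω).iter j)‖ ≤ K * ε := by
      intro ω
      have h2 := Finset.sum_le_card_nsmul (Finset.range K) (fun j => ‖gradient f ((T ω).iter j)‖) ε
        fun j hj => by
          have hj' := Finset.mem_range.mp hj
          exact (hle ω j hj'.le).trans (gradient_bound_of_small_gap hL hΔpos hε hα hKlt hg hsmall.le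
            hη (by exact_mod_cast hj'))
      simpa using h2
    calc _ ≤ ∫ _, (K * ε : ℝ) ∂μ := integral_mono_of_nonneg
          (Filter.Eventually.of_forall fun ω => by positivity) (integrable_const _)
          (Filter.Eventually.of_forall h1)
      _ = K * ε := by simp

lemma final_clock_le_timeRate {p σ ε L Δ : ℝ}
    (hp₁ : 1 < p) (hL : 0 < L) (hσ : 0 ≤ σ) (hε : 0 < ε) (hΔpos : 0 < Δ)
    (hn : 1 ≤ n) (hτ : ∀ i, 0 < τ i)
    (hrun : IsFixedComputation μ ℱ D τ G (paramK p σ ε L Δ) (paramR p σ ε) (paramEta p σ ε L)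
      (paramBeta p σ ε) x₀ c z h) (hsmall : ε ≤ √(2 * L * Δ)) (ω : Ω) :
    (final G (paramK p σ ε L Δ) (paramR p σ ε) (paramEta p σ ε L)
      (paramBeta p σ ε) x₀ (fun s => c s ω) (fun s => z s ω) (fun s i => h s i ω)).clock ≤
      74 * (4 + (3 * 2 ^ ((p + 1) / p)) ^ (p / (p - 1))) * timeRate hn τ L Δ σ p ε := by
  unfold timeRate
  obtain ⟨m, hm, heq⟩ := Finset.exists_mem_eq_inf' (Finset.nonempty_Icc.mpr hn) fun m : ℕ =>
    ((1 / (m : ℝ)) * ∑ i ∈ Finset.univ.filter (fun i : Fin n => (i : ℕ) < m), 1 / τ i)⁻¹ *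
      (L * Δ / ε ^ 2 +
        L * σ ^ (p / (p - 1)) * Δ / ((m : ℝ) * ε ^ ((3 * p - 2) / (p - 1))))
  rw [heq]
  obtain ⟨hm1, hmn⟩ := Finset.mem_Icc.mp hm
  set A := Finset.univ.filter (fun i : Fin n => (i : ℕ) < m)
  have hA : A.Nonempty := ⟨⟨0, by omega⟩, by simp only [A, Finset.mem_filter]; simp; omega⟩
  have hcard : A.card ≤ m := by
    have h1 := Finset.card_le_card_of_injOn (s := A) (t := Finset.range m) (fun i : Fin n => (i : ℕ))
      (fun i hi => by simpa [A] using hi) (fun i _ j _ hij => Fin.ext hij)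
    simpa using h1
  have hpos : 0 < ∑ i ∈ A, 1 / τ i := Finset.sum_pos (fun i _ => by have := hτ i; positivity) hA
  exact (final_clock_le G x₀ _ _ _ (paramK_pos hσ hε hL hΔpos) (paramR_pos hσ hε) hτ
    (fun s i => hrun.duration_nonneg s i ω) (fun s i => hrun.duration_le s i ω)
    (fun s i => hrun.earliest s ω i) hA).trans
    (epochs_mul_time_le hp₁ hσ hε hL hΔpos hsmall hm1 hcard hpos)

end IsFixedComputation

end

theorem mainTheorem2 (p : ℝ) (hp₁ : 1 < p) (hp₂ : p ≤ 2) :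
    ∃ C : ℝ, 0 < C ∧
      ∀ (n d : ℕ) (hn : 1 ≤ n) (τ : Fin n → ℝ) (_hτ : ∀ i, 0 < τ i)
        (L σ ε : ℝ) (_hL : 0 < L) (_hσ : 0 ≤ σ) (_hε : 0 < ε)
        (f : EuclideanSpace ℝ (Fin d) → ℝ) (_hf : IsSmoothObjective f L)
        (x₀ : EuclideanSpace ℝ (Fin d)) (Δ : ℝ) (_hΔ : Δ = initialGap f x₀) (_hΔpos : 0 < Δ)
        (Ξ : Type*) [MeasurableSpace Ξ] (D : Measure Ξ) [IsProbabilityMeasure D]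
        (G : EuclideanSpace ℝ (Fin d) → Ξ → EuclideanSpace ℝ (Fin d))
        (_hG : IsPBCMOracle D f G p σ)
        (K R : ℕ) (η β : ℝ) (_hK : K = paramK p σ ε L Δ) (_hR : R = paramR p σ ε)
        (_hη : η = paramEta p σ ε L) (_hβ : β = paramBeta p σ ε)
        (Ω : Type*) [mΩ : MeasurableSpace Ω] (μ : Measure Ω) [IsProbabilityMeasure μ]
        (ℱ : Filtration ℕ mΩ)
        (c : ℕ → Ω → Fin n) (z : ℕ → Ω → Ξ) (h : ℕ → Fin n → Ω → ℝ)
        (_hrun : IsFixedComputation μ ℱ D τ G K R η β x₀ c z h)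
        (J : Ω → ℕ) (_hJ : IsUniformIndex μ ℱ K J)
        (out : Ω → RState n d)
        (_hout : ∀ ω, out ω =
          RState.final G K R η β x₀ (fun s => c s ω) (fun s => z s ω) (fun s i => h s i ω)),
        (∀ ω, (out ω).k = K) ∧
        IsEpsStationary μ f ε (fun ω => (out ω).iter (J ω)) ∧
        (ε ≤ √(2 * L * Δ) → ∀ ω, (out ω).clock ≤ C * timeRate hn τ L Δ σ p ε) ∧
        (√(2 * L * Δ) < ε → ‖gradient f x₀‖ ≤ ε) := by
  -- The factor `74` pays for the number of epochs, the bracket for the length `R + 2 m` of one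
  -- epoch.
  refine ⟨74 * (4 + (3 * 2 ^ ((p + 1) / p)) ^ (p / (p - 1))), by positivity, ?_⟩
  intro n d hn τ hτ L σ ε hL hσ hε f hf x₀ Δ hΔ hΔpos Ξ _ D _ G hG K R η β hK hR hη hβ Ω mΩ μ _
    ℱ c z h hrun J hJ out hout
  subst hK hR hη hβ
  obtain rfl : out = _ := funext hout
  refine ⟨fun ω => RState.final_k G x₀ _ _ _ (paramR_pos hσ hε),
    hrun.isEpsStationary hp₁ hp₂ hL hσ hε hf hΔ hΔpos hG hJ,
    fun hsmall ω => hrun.final_clock_le_timeRate hp₁ hL hσ hε hΔpos hn hτ hsmall ω, fun hlt => ?_⟩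
  have hg := hf.norm_gradient_le hL x₀
  rw [← hΔ] at hg
  exact hg.trans hlt.le
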